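/- Let $p$ be an odd prime, let $e\equiv 0\pmod 4$ be a positive integer and $q=p^e$. Let $\mathrm{Tr}$ be the absolute trace from $\mathbb{F}_q$ to $\mathbb{F}_p$, let $\eta$ be the quadratic character of $\mathbb{F}_p$, and let $C_0$ and $C_1$ be the sets of squares and of non-squares in $\mathbb{F}_p^*$. For $i\in\{0,1\}$ put $$D_i=\{x\in\mathbb{F}_q:\mathrm{Tr}(x^{p+1}-x)\in C_i\},\qquad \mathcal{C}_{D_i}=\{(\mathrm{Tr}(ax))_{x\in D_i}:a\in\mathbb{F}_q\},$$ a linear code over $\mathbb{F}_p$. Suppose that $\left(\frac{e}{p}\right)=(-1)^{1-i}$. Then the code $\mathcal{C}_{D_i}$ has length $$|D_i|=\frac{p-1}{2}p^{e-1}-\frac{1-\eta(-1)p}{2}p^{e/2}$$ and at most $6$ nonzero weights. If moreover $(p,e)\neq(3,4)$, then it has dimension $e$, and its weight distribution is given by Table A if $p\equiv 1\pmod 4$ and by Table B if $p\equiv 3\pmod 4$: the number of codewords of Hamming weight $w$ is the sum of the multiplicities in the rows whose weight is $w$. Table A (weight: multiplicity): - $0$: $1$ - $\frac{(p-1)^2}{2}p^{e-2}+\frac{(p-1)^2}{2}p^{e/2-1}$: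 $p^e-p^{e-2}$ - $\frac{(p-1)^2}{2}p^{e-2}$: $p^{e-3}-1$ - $\frac{(p-1)^2}{2}p^{e-2}+\frac{p-1}{2}p^{e/2}$: $\frac{p^2-1}{2}p^{e-4}$ - $\frac{(p-1)^2}{2}p^{e-2}+\frac{p-3}{2}p^{e/2}$: $\frac{(p-1)^2}{4}p^{e-4}-\frac{(p-1)^2}{4}p^{e/2-2}$ - $\frac{(p-1)^2}{2}p^{e-2}+\frac{p+1}{2}p^{e/2}$: $\frac{(p-1)^2}{4}p^{e-4}+\frac{(p-1)^2}{4}p^{e/2-2}$ Table B (weight: multiplicity): - $0$: $1$ - $\frac{(p-1)^2}{2}p^{e-2}-\frac{p^2-1}{2}p^{e/2-1}$: $p^e-p^{e-2}$ - $\frac{(p-1)^2}{2}p^{e-2}$: $p^{e-4}-1$ - $\frac{(p-1)^2}{2}p^{e-2}-\frac{p+1}{2}p^{e/2}$: $\frac{p^2-1}{2}p^{e-4}-(p-1)p^{e/2-2}$ - $\frac{(p-1)^2}{2}p^{e-2}-\frac{p+3}{2}p^{e/2}$: $\frac{(p-1)(p-3)}{4}p^{e-4}-\frac{(p-1)(p-3)}{4}p^{e/2-2}$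 - $\frac{(p-1)^2}{2}p^{e-2}-\frac{p-1}{2}p^{e/2}$: $\frac{p^2-1}{4}p^{e-4}+\frac{p^2-1}{4}p^{e/2-2}$ - $\frac{(p-1)^2}{2}p^{e-2}-p^{e/2}$: $(p-1)p^{e-4}$ -/

import Mathlib

/-- The cyclotomic classes of order `2` in `𝔽_p^*`: `C_0` is the set of nonzero squares and `C_1` is
the set of non-squares (which are automatically nonzero). -/
def cyclotomicClass (p : ℕ) (i : Fin 2) : Set (ZMod p) :=
  if i = 0 then {c | c ≠ 0 ∧ IsSquare c} else {c | ¬ IsSquare c}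

open Classical in
/-- The defining set `D_i = {x ∈ F : Tr (x ^ (p + 1) - x) ∈ C_i}`. -/
noncomputable def definingSet (p : ℕ) (F : Type*) [Field F] [Fintype F] [Algebra (ZMod p) F]
    (i : Fin 2) : Finset F :=
  Finset.univ.filter fun x : F =>
    Algebra.trace (ZMod p) F (x ^ (p + 1) - x) ∈ cyclotomicClass p i

/-- The linear map `a ↦ c(a) = (Tr (a x))_{x ∈ D}`. -/
noncomputable def codeword (p : ℕ) {F : Type*} [Field F] [Algebra (ZMod p) F] (D : Finset F) :
    F →ₗ[ZMod p] (D → ZMod p) :=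
  LinearMap.pi fun x : D => (Algebra.trace (ZMod p) F).comp (LinearMap.mulRight (ZMod p) (x : F))

/-- Sanity check: `c(a)` has the coordinates `Tr (a x)`, `x ∈ D`. -/
theorem codeword_apply (p : ℕ) {F : Type*} [Field F] [Algebra (ZMod p) F] (D : Finset F)
    (a : F) (x : D) : codeword p D a x = Algebra.trace (ZMod p) F (a * (x : F)) := rfl

/-- The linear code `C_D = {c(a) : a ∈ F}` over `𝔽_p` with defining set `D`; its length is the
number of elements of `D`. -/
noncomputable def traceCode (p : ℕ) {F : Type*} [Field F] [Algebra (ZMod p) F] (D : Finset F) :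
    Submodule (ZMod p) (D → ZMod p) :=
  LinearMap.range (codeword p D)

/-- `A_w`: the number of codewords of Hamming weight `w` in the code `C`. -/
noncomputable def weightCount {p : ℕ} {ι : Type*} [Fintype ι]
    (C : Submodule (ZMod p) (ι → ZMod p)) (w : ℕ) : ℕ :=
  Set.ncard {c : ι → ZMod p | c ∈ C ∧ hammingNorm c = w}

/-- The multiplicity that a table of rows (weight, multiplicity) gives to the weight `w`: the sum of
the multiplicities of all rows of weight `w` (different rows may happen to have equal weights). -/
def tableMultiplicity (T : List (ℚ × ℚ)) (w : ℕ) : ℚ :=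
  (T.map fun r => if r.1 = (w : ℚ) then r.2 else 0).sum

/-- The weight table for `p ≡ 1 (mod 4)`; rows are (weight, multiplicity). -/
def weightTableOne (p e : ℕ) : List (ℚ × ℚ) :=
  [ (0, 1),
    (((p : ℚ) - 1) ^ 2 / 2 * (p : ℚ) ^ (e - 2) + ((p : ℚ) - 1) ^ 2 / 2 * (p : ℚ) ^ (e / 2 - 1),
      (p : ℚ) ^ e - (p : ℚ) ^ (e - 2)),
    (((p : ℚ) - 1) ^ 2 / 2 * (p : ℚ) ^ (e - 2),
      (p : ℚ) ^ (e - 3) - 1),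
    (((p : ℚ) - 1) ^ 2 / 2 * (p : ℚ) ^ (e - 2) + ((p : ℚ) - 1) / 2 * (p : ℚ) ^ (e / 2),
      ((p : ℚ) ^ 2 - 1) / 2 * (p : ℚ) ^ (e - 4)),
    (((p : ℚ) - 1) ^ 2 / 2 * (p : ℚ) ^ (e - 2) + ((p : ℚ) - 3) / 2 * (p : ℚ) ^ (e / 2),
      ((p : ℚ) - 1) ^ 2 / 4 * (p : ℚ) ^ (e - 4)
        - ((p : ℚ) - 1) ^ 2 / 4 * (p : ℚ) ^ (e / 2 - 2)),
    (((p : ℚ) - 1) ^ 2 / 2 * (p : ℚ) ^ (e - 2) + ((p : ℚ) + 1) / 2 * (p : ℚ) ^ (e / 2),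
      ((p : ℚ) - 1) ^ 2 / 4 * (p : ℚ) ^ (e - 4)
        + ((p : ℚ) - 1) ^ 2 / 4 * (p : ℚ) ^ (e / 2 - 2)) ]

/-- The weight table for `p ≡ 3 (mod 4)`; rows are (weight, multiplicity). -/
def weightTableThree (p e : ℕ) : List (ℚ × ℚ) :=
  [ (0, 1),
    (((p : ℚ) - 1) ^ 2 / 2 * (p : ℚ) ^ (e - 2) - ((p : ℚ) ^ 2 - 1) / 2 * (p : ℚ) ^ (e / 2 - 1),
      (p : ℚ) ^ e - (p : ℚ) ^ (e - 2)),
    (((p : ℚ) - 1) ^ 2 / 2 * (p : ℚ) ^ (e - 2),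
      (p : ℚ) ^ (e - 4) - 1),
    (((p : ℚ) - 1) ^ 2 / 2 * (p : ℚ) ^ (e - 2) - ((p : ℚ) + 1) / 2 * (p : ℚ) ^ (e / 2),
      ((p : ℚ) ^ 2 - 1) / 2 * (p : ℚ) ^ (e - 4) - ((p : ℚ) - 1) * (p : ℚ) ^ (e / 2 - 2)),
    (((p : ℚ) - 1) ^ 2 / 2 * (p : ℚ) ^ (e - 2) - ((p : ℚ) + 3) / 2 * (p : ℚ) ^ (e / 2),
      ((p : ℚ) - 1) * ((p : ℚ) - 3) / 4 * (p : ℚ) ^ (e - 4)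
        - ((p : ℚ) - 1) * ((p : ℚ) - 3) / 4 * (p : ℚ) ^ (e / 2 - 2)),
    (((p : ℚ) - 1) ^ 2 / 2 * (p : ℚ) ^ (e - 2) - ((p : ℚ) - 1) / 2 * (p : ℚ) ^ (e / 2),
      ((p : ℚ) ^ 2 - 1) / 4 * (p : ℚ) ^ (e - 4)
        + ((p : ℚ) ^ 2 - 1) / 4 * (p : ℚ) ^ (e / 2 - 2)),
    (((p : ℚ) - 1) ^ 2 / 2 * (p : ℚ) ^ (e - 2) - (p : ℚ) ^ (e / 2),
      ((p : ℚ) - 1) * (p : ℚ) ^ (e - 4)) ]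

/-! Put `Q x = Tr (x ^ (p + 1))`, a quadratic form on `F` over `𝔽_p`, and `y = 1/2`. Since `polar Q
y x = Tr x`, completing the square gives `Tr (x ^ (p + 1) - x) = Q (x - y) - Q y` with `Q y = e/4`.
The hypothesis on `e` says that the quadratic character χ of `Q y` is opposite to the sign selecting
`C_i`. Hence the defining set depends only on `Q` and `y`: it is `oppositeSet Q y`. As the trace
form is nondegenerate, codewords correspond to linear forms `l` on `F`, with weight `formWeight Q y
l`.

The level sets of `Q` are found without Gauss sums (`mul_levelCard_normTraceForm`). Scaling by an
element of norm type makes all nonzero levels equally large. The radical has `p ^ 2` elements, so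
the second moment fixes the difference between the zero level and a nonzero level up to sign. A
divisibility by `p ^ 2 - 1` then fixes the sign.

A form that does not vanish on the radical is equidistributed on the set and gives the first nonzero
row of each table. Any other form is `polar Q x` for some `x`. Summing level sizes over translates
by multiples of `x` counts the points with given `Q u` and `polar Q x u`
(`card_mul_card_level_inter`), so the weight depends only on the number of `g` for which `χ (-v g² +
t g - c)` is `-χ c`, where `v = Q x`, `t = polar Q x y`, `c = Q y`. The same count with `y` in place
of `x` gives the joint distribution of `(v, t)`. Quadratic character sums evaluate both, and
`sum_comp_formWeight_eq` collects the result into a weight enumerator valid for either value of `χ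
(-1)`.

The enumerator runs over `a ∈ F`, not over codewords. The two agree when only `a = 0` has weight
zero, which the tables show outside `(p, e) = (3, 4)`. The bound on the number of weights needs no
injectivity. -/

/-! ### Quadratic forms and their polar forms -/

theorem map_add_smul {k V : Type*} [Field k] [AddCommGroup V] [Module k V]
    (Q : QuadraticForm k V) (u y : V) (t : k) :
    Q (u + t • y) = Q u + t * QuadraticMap.polar Q y u + t ^ 2 * Q y := by
  have h := QuadraticMap.map_add Q u (t • y)
  rw [h, QuadraticMap.map_smul, QuadraticMap.polar_smul_right, QuadraticMap.polar_comm Q u y]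
  simp only [smul_eq_mul]
  ring

/-- A linear form that vanishes on the radical is represented by the polar form. -/
theorem exists_polarBilin_eq {k V : Type*} [Field k] [AddCommGroup V] [Module k V]
    [FiniteDimensional k V] (Q : QuadraticForm k V) (l : Module.Dual k V)
    (hl : ∀ x ∈ LinearMap.ker Q.polarBilin, l x = 0) : ∃ y, Q.polarBilin y = l := by
  have hflip : Q.polarBilin.flip = Q.polarBilin := by
    ext x y
    simp [QuadraticMap.polar_comm Q x y]
  have h := LinearMap.range_dualMap_eq_dualAnnihilator_ker (K := k) Q.polarBilin
  have hmem : l ∈ (LinearMap.ker Q.polarBilin).dualAnnihilator :=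
    (Submodule.mem_dualAnnihilator _).mpr hl
  rw [← h] at hmem
  obtain ⟨f, hf⟩ := hmem
  obtain ⟨y, rfl⟩ := (Module.evalEquiv k V).surjective f
  refine ⟨y, ?_⟩
  rw [← hf]
  ext u
  simp [QuadraticMap.polar_comm Q y u]

/-! ### Level sets of quadratic forms over finite fields -/

section LevelSets

variable {k V : Type*} [Field k] [Fintype k] [DecidableEq k] [AddCommGroup V] [Module k V]
  [Fintype V]

/-- The number of vectors on which a quadratic form takes the value `s`. -/
def levelCard (Q : QuadraticForm k V) (s : k) : ℕ :=
  (Finset.univ.filter fun u : V => Q u = s).card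

/-- A linear form that is nonzero on a direction of invariance of a set is equidistributed on that
set. -/
theorem card_mul_card_fiber_of_invariant (P : V → Prop) [DecidablePred P] (x : V)
    (hP : ∀ (t : k) (u : V), P (u + t • x) ↔ P u) (l : V →ₗ[k] k) (hl : l x ≠ 0) (r : k) :
    Fintype.card k * (Finset.univ.filter fun u => P u ∧ l u = r).card
      = (Finset.univ.filter P).card := by
  have key : ∀ r' : k, (Finset.univ.filter fun u => P u ∧ l u = r').card
      = (Finset.univ.filter fun u => P u ∧ l u = r).card := by
    intro r'
    -- This translation along the invariant direction carries the fibre over `r'` to the fibre over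
    -- `r`.
    refine Finset.card_equiv (Equiv.addRight (((r - r') / l x) • x)) fun u => ?_
    simp only [Finset.mem_filter, Finset.mem_univ, true_and, Equiv.coe_addRight, hP, map_add,
      map_smul, smul_eq_mul, div_mul_cancel₀ _ hl]
    refine and_congr_right fun _ => ⟨fun h => by rw [h]; ring, fun h => ?_⟩
    linear_combination h
  rw [Finset.card_eq_sum_card_fiberwise (s := Finset.univ.filter P) (f := l)
    (t := Finset.univ) (fun _ _ => Finset.mem_univ _)]
  simp only [Finset.filter_filter, key, Finset.sum_const, Finset.card_univ, smul_eq_mul]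

theorem card_mul_card_fiber (l : V →ₗ[k] k) (hl : l ≠ 0) (r : k) :
    Fintype.card k * (Finset.univ.filter fun u => l u = r).card = Fintype.card V := by
  obtain ⟨x, hx⟩ : ∃ x, l x ≠ 0 := by
    by_contra! h
    exact hl (LinearMap.ext h)
  simpa using card_mul_card_fiber_of_invariant (fun _ => True) x (by simp) l hx r

theorem sum_levelCard (Q : QuadraticForm k V) : ∑ s, levelCard Q s = Fintype.card V := by
  rw [← Finset.card_univ, Finset.card_eq_sum_card_fiberwise (f := Q) (t := Finset.univ)
    (fun _ _ => Finset.mem_univ _)]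
  rfl

/-- The sum of squares counts pairs with equal value. Writing a pair as `(u + y, y)` turns equality
of values into the condition `polar Q u y = -Q u`, linear in `y`. It holds for every `y` if `u` is
in the radical (where `Q u = 0`, as 2 is invertible), and for one in `|k|` otherwise. -/
theorem card_mul_sum_levelCard_sq (Q : QuadraticForm k V) (h2 : (2 : k) ≠ 0) :
    (Fintype.card k : ℤ) * ∑ s, (levelCard Q s : ℤ) ^ 2
      = (Fintype.card V : ℤ) ^ 2
        + (Fintype.card k - 1) * Fintype.card V * Nat.card (LinearMap.ker Q.polarBilin) := by
  classical
  have hpair : ∑ s, (levelCard Q s : ℤ) ^ 2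
      = ∑ u : V, ((Finset.univ.filter fun y => Q.polarBilin u y = -Q u).card : ℤ) := by
    have e1 : ∀ s, (levelCard Q s : ℤ) ^ 2
        = ∑ y : V, ∑ x : V, if Q y = s ∧ Q x = s then 1 else 0 := by
      intro s
      simp only [levelCard, sq, Finset.natCast_card_filter, Finset.sum_mul_sum]
      refine Finset.sum_congr rfl fun y _ => Finset.sum_congr rfl fun x _ => ?_
      split_ifs <;> simp_all
    simp only [e1]
    rw [Finset.sum_comm]
    have e2 : ∀ y : V, ∑ s : k, ∑ x : V, (if Q y = s ∧ Q x = s then (1 : ℤ) else 0)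
        = ∑ u : V, if Q.polarBilin u y = -Q u then (1 : ℤ) else 0 := by
      intro y
      rw [Finset.sum_comm]
      rw [← Equiv.sum_comp (Equiv.addRight y)]
      refine Finset.sum_congr rfl fun u _ => ?_
      have : Q (u + y) = Q u + Q y + QuadraticMap.polar Q u y := QuadraticMap.map_add Q u y
      simp only [Equiv.coe_addRight, ite_and, Finset.sum_ite_eq, Finset.mem_univ, if_true,
        QuadraticMap.polarBilin_apply_apply, this]
      refine if_congr ⟨fun h => by linear_combination h, fun h => by linear_combination h⟩ rfl rfl
    simp only [e2]
    rw [Finset.sum_comm]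
    simp only [Finset.natCast_card_filter]
  have hterm : ∀ u : V, (Fintype.card k : ℤ)
      * ((Finset.univ.filter fun y => Q.polarBilin u y = -Q u).card : ℤ)
      = Fintype.card V
        + if u ∈ LinearMap.ker Q.polarBilin then ((Fintype.card k : ℤ) - 1) * Fintype.card V
          else 0 := by
    intro u
    split_ifs with hu
    · rw [LinearMap.mem_ker] at hu
      have hQ : Q u = 0 := by
        have h := QuadraticMap.polar_self Q u
        rw [← QuadraticMap.polarBilin_apply_apply, hu] at h
        simp only [LinearMap.zero_apply, two_smul, ← two_mul] at h
        exact (mul_eq_zero.mp h.symm).resolve_left h2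
      simp [hu, hQ]
      ring
    · rw [LinearMap.mem_ker] at hu
      have := card_mul_card_fiber (Q.polarBilin u) hu (-Q u)
      rw [add_zero]
      exact_mod_cast this
  rw [hpair, Finset.mul_sum, Finset.sum_congr rfl fun u _ => hterm u, Finset.sum_add_distrib,
    ← Finset.sum_filter, Finset.sum_const, Finset.sum_const, Finset.card_univ,
    Nat.card_eq_fintype_card, Fintype.card_subtype]
  simp only [nsmul_eq_mul]
  ring

/-- Counting over the lines through a point of the `(Q u, polar Q y u)`-plane. -/
theorem card_mul_card_level_inter (Q : QuadraticForm k V) (y : V) (hy : Q.polarBilin y ≠ 0)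
    (s r : k) :
    (Fintype.card k : ℤ) *
        ((Fintype.card k : ℤ)
          * (Finset.univ.filter fun u => Q u = s ∧ QuadraticMap.polar Q y u = r).card)
      = (Fintype.card k : ℤ) * ∑ t : k, (levelCard Q (s + t * r + t ^ 2 * Q y) : ℤ)
        + Fintype.card V - Fintype.card k * Fintype.card V := by
  have h1 : ∑ t : k, (levelCard Q (s + t * r + t ^ 2 * Q y) : ℤ)
      = ∑ u : V, ∑ t : k, if Q u + t * QuadraticMap.polar Q y u = s + t * r then (1 : ℤ) else 0 := by
    rw [Finset.sum_comm]
    refine Finset.sum_congr rfl fun t _ => ?_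
    rw [levelCard, Finset.natCast_card_filter, ← Equiv.sum_comp (Equiv.addRight (t • y))]
    refine Finset.sum_congr rfl fun u _ => ?_
    simp only [Equiv.coe_addRight, map_add_smul, add_left_inj]
  -- The condition is linear in `t`. If `polar Q y u = r` it holds for all `t` or for none,
  -- according to whether `Q u = s`; otherwise exactly one `t` satisfies it.
  have h2 : ∀ u : V,
      (∑ t : k, if Q u + t * QuadraticMap.polar Q y u = s + t * r then (1 : ℤ) else 0)
      = 1 - (if QuadraticMap.polar Q y u = r then 1 else 0)
        + Fintype.card k * (if Q u = s ∧ QuadraticMap.polar Q y u = r then 1 else 0) := by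
    intro u
    by_cases hr : QuadraticMap.polar Q y u = r
    · simp only [hr, add_left_inj, and_true, if_true]
      by_cases hs : Q u = s <;> simp [hs]
    · have hr' : QuadraticMap.polar Q y u - r ≠ 0 := sub_ne_zero.mpr hr
      have : ∀ t : k, (Q u + t * QuadraticMap.polar Q y u = s + t * r)
          ↔ t = (s - Q u) / (QuadraticMap.polar Q y u - r) := by
        intro t
        rw [eq_div_iff hr']
        exact ⟨fun h => by linear_combination h, fun h => by linear_combination h⟩
      simp [this, hr]
  have h3 : (Fintype.card k : ℤ) * (∑ u : V, if QuadraticMap.polar Q y u = r then (1 : ℤ) else 0)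
      = Fintype.card V := by
    have := card_mul_card_fiber (Q.polarBilin y) hy r
    simp only [QuadraticMap.polarBilin_apply_apply] at this
    rw [← Finset.natCast_card_filter]
    exact_mod_cast this
  rw [h1, Finset.sum_congr rfl fun u _ => h2 u, Finset.sum_add_distrib, Finset.sum_sub_distrib,
    ← Finset.mul_sum, ← Finset.natCast_card_filter (fun u => Q u = s ∧ _)]
  simp only [Finset.sum_const, Finset.card_univ, nsmul_eq_mul, mul_one]
  linear_combination h3

end LevelSets

/-! ### Quadratic character sums -/

/-- This is the substitution that completes the square in `a t² + b t + c`. -/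
theorem bijective_two_mul_add {k : Type*} [Field k] [Finite k] (h2 : ringChar k ≠ 2)
    {a : k} (ha : a ≠ 0) (b : k) :
    Function.Bijective fun t : k => 2 * a * t + b := by
  have h : 2 * a ≠ 0 := mul_ne_zero (Ring.two_ne_zero h2) ha
  refine Finite.injective_iff_bijective.mp fun x y hxy => ?_
  exact mul_left_cancel₀ h (add_right_cancel hxy)

section QuadraticCharSums

variable {k : Type*} [Field k] [Fintype k] [DecidableEq k]

theorem card_sq_eq (h2 : ringChar k ≠ 2) (a : k) :
    ((Finset.univ.filter fun x : k => x ^ 2 = a).card : ℤ) = quadraticChar k a + 1 := by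
  rw [← quadraticChar_card_sqrts h2 a]
  congr 2
  ext x
  simp

theorem card_mul_eq {w : k} (hw : w ≠ 0) :
    ∑ x : k, ∑ y : k, (if x * y = w then (1 : ℤ) else 0) = Fintype.card k - 1 := by
  have h : ∀ x : k, ∑ y : k, (if x * y = w then (1 : ℤ) else 0) = 1 - if x = 0 then 1 else 0 := by
    intro x
    by_cases hx : x = 0
    · simp [hx, hw.symm]
    · have : ∀ y, x * y = w ↔ y = w / x := fun y => by rw [eq_div_iff hx, mul_comm]
      simp [this, hx]
  simp [h]

/-- The character sum over the values of `t ^ 2 - w`. -/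
theorem sum_quadraticChar_sq_sub (h2 : ringChar k ≠ 2) (w : k) :
    ∑ t : k, quadraticChar k (t ^ 2 - w)
      = if w = 0 then (Fintype.card k : ℤ) - 1 else -1 := by
  have h20 : (2 : k) ≠ 0 := Ring.two_ne_zero h2
  split_ifs with hw
  · have : ∀ t : k, quadraticChar k (t ^ 2 - w) = 1 - if t = 0 then 1 else 0 := by
      intro t
      by_cases ht : t = 0
      · simp [hw, ht]
      · simp [hw, ht, quadraticChar_sq_one' ht]
    simp [this]
  · have h1 : ∀ t : k, quadraticChar k (t ^ 2 - w)
        = (∑ z : k, if (t - z) * (t + z) = w then (1 : ℤ) else 0) - 1 := by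
      intro t
      rw [eq_sub_iff_add_eq, ← card_sq_eq h2, Finset.natCast_card_filter]
      refine Finset.sum_congr rfl fun z _ => if_congr ?_ rfl rfl
      exact ⟨fun h => by linear_combination -h, fun h => by linear_combination -h⟩
    -- The invertible change of variables `x = t - z`, `y = t + z` turns the conic into the
    -- hyperbola `x y = w`.
    have h3 : ∑ t : k, ∑ z : k, (if (t - z) * (t + z) = w then (1 : ℤ) else 0)
        = ∑ x : k, ∑ y : k, if x * y = w then (1 : ℤ) else 0 := by
      rw [← Fintype.sum_prod_type', ← Fintype.sum_prod_type' (f := fun x y : k => if x * y = w then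
        (1 : ℤ) else 0)]
      refine Fintype.sum_bijective (fun a : k × k => (a.1 - a.2, a.1 + a.2)) ?_ _ _ fun _ => rfl
      refine Finite.injective_iff_bijective.mp fun a b hab => ?_
      simp only [Prod.mk.injEq] at hab
      have e1 : 2 * (a.1 - b.1) = 0 := by linear_combination hab.1 + hab.2
      have e2 : 2 * (a.2 - b.2) = 0 := by linear_combination hab.2 - hab.1
      exact Prod.ext (sub_eq_zero.mp ((mul_eq_zero.mp e1).resolve_left h20))
        (sub_eq_zero.mp ((mul_eq_zero.mp e2).resolve_left h20))
    rw [Finset.sum_congr rfl fun t _ => h1 t, Finset.sum_sub_distrib, h3, card_mul_eq hw]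
    simp

/-- The character sum over the values of a quadratic polynomial. -/
theorem sum_quadraticChar_quadratic (h2 : ringChar k ≠ 2) {a : k} (ha : a ≠ 0) (b c : k) :
    ∑ t : k, quadraticChar k (a * t ^ 2 + b * t + c)
      = quadraticChar k a * if b ^ 2 - 4 * a * c = 0 then (Fintype.card k : ℤ) - 1 else -1 := by
  rw [← sum_quadraticChar_sq_sub h2, Finset.mul_sum]
  refine Fintype.sum_bijective _ (bijective_two_mul_add h2 ha b) _ _ fun t => ?_
  have h : (2 * a * t + b) ^ 2 - (b ^ 2 - 4 * a * c) = a * (2 ^ 2 * (a * t ^ 2 + b * t + c)) := by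
    ring
  rw [h, map_mul, map_mul, quadraticChar_sq_one' (Ring.two_ne_zero h2), one_mul, ← mul_assoc, ← sq,
    quadraticChar_sq_one ha, one_mul]

/-- The number of roots of a quadratic polynomial. -/
theorem card_roots_quadratic (h2 : ringChar k ≠ 2) {a : k} (ha : a ≠ 0) (b c : k) :
    ((Finset.univ.filter fun t : k => a * t ^ 2 + b * t + c = 0).card : ℤ)
      = 1 + quadraticChar k (b ^ 2 - 4 * a * c) := by
  rw [add_comm, ← card_sq_eq h2]
  congr 1
  refine Finset.card_bijective _ (bijective_two_mul_add h2 ha b) fun t => ?_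
  simp only [Finset.mem_filter, Finset.mem_univ, true_and]
  have h : (2 * a * t + b) ^ 2 - (b ^ 2 - 4 * a * c) = 2 ^ 2 * a * (a * t ^ 2 + b * t + c) := by
    ring
  rw [← sub_eq_zero (a := (2 * a * t + b) ^ 2), h, mul_eq_zero_iff_left]
  exact mul_ne_zero (pow_ne_zero _ (Ring.two_ne_zero h2)) ha

/-- Counting the arguments at which the quadratic character takes a given nonzero value. -/
theorem two_mul_card_quadraticChar_eq {ι : Type*} [Fintype ι] (g : ι → k) {ε : ℤ}
    (hε : ε = 1 ∨ ε = -1) :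
    2 * ((Finset.univ.filter fun x => quadraticChar k (g x) = ε).card : ℤ)
      = Fintype.card ι - (Finset.univ.filter fun x => g x = 0).card
        + ε * ∑ x, quadraticChar k (g x) := by
  have h : ∀ x, 2 * (if quadraticChar k (g x) = ε then (1 : ℤ) else 0)
      = 1 - (if g x = 0 then 1 else 0) + ε * quadraticChar k (g x) := by
    intro x
    by_cases hx : g x = 0
    · rcases hε with rfl | rfl <;> simp [hx]
    · rcases quadraticChar_dichotomy hx with h | h <;> rcases hε with rfl | rfl <;> simp [hx, h]
  rw [Finset.natCast_card_filter, Finset.natCast_card_filter, Finset.mul_sum,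
    Finset.sum_congr rfl fun x _ => h x, Finset.sum_add_distrib, Finset.sum_sub_distrib,
    Finset.mul_sum]
  simp

/-- Sums of functions of the quadratic character. -/
theorem sum_comp_quadraticChar {ι : Type*} [Fintype ι] (g : ι → k) (Φ : ℤ → ℚ) :
    ∑ x, Φ (quadraticChar k (g x))
      = (Finset.univ.filter fun x => g x = 0).card * Φ 0
        + (Finset.univ.filter fun x => quadraticChar k (g x) = 1).card * Φ 1
        + (Finset.univ.filter fun x => quadraticChar k (g x) = -1).card * Φ (-1) := by
  simp only [Finset.natCast_card_filter, Finset.sum_mul, ← Finset.sum_add_distrib]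
  refine Finset.sum_congr rfl fun x _ => ?_
  by_cases hx : g x = 0
  · simp [hx]
  · rcases quadraticChar_dichotomy hx with h | h <;> simp [hx, h]

/-- The number of zeros and the character sum together determine how often each of the values `0`,
`1`, `-1` is taken. -/
theorem sum_comp_quadraticChar_sq_sub (h2 : ringChar k ≠ 2) {w : k} (hw : w ≠ 0) (Φ : ℤ → ℚ) :
    ∑ t : k, Φ (quadraticChar k (t ^ 2 - w))
      = (1 + quadraticChar k w) * Φ 0
        + ((Fintype.card k : ℚ) - 2 - quadraticChar k w) / 2 * Φ 1
        + ((Fintype.card k : ℚ) - quadraticChar k w) / 2 * Φ (-1) := by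
  have hZ : ((Finset.univ.filter fun t : k => t ^ 2 - w = 0).card : ℤ) = quadraticChar k w + 1 := by
    simp only [sub_eq_zero]
    exact card_sq_eq h2 w
  have hp := two_mul_card_quadraticChar_eq (fun t : k => t ^ 2 - w) (Or.inl rfl)
  have hm := two_mul_card_quadraticChar_eq (fun t : k => t ^ 2 - w) (Or.inr rfl)
  rw [sum_quadraticChar_sq_sub h2, if_neg hw, hZ] at hp hm
  rw [sum_comp_quadraticChar]
  have hZ' := congrArg (Int.cast : ℤ → ℚ) hZ
  have hp' := congrArg (Int.cast : ℤ → ℚ) hp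
  have hm' := congrArg (Int.cast : ℤ → ℚ) hm
  push_cast at hZ' hp' hm'
  linear_combination Φ 0 * hZ' + Φ 1 / 2 * hp' + Φ (-1) / 2 * hm'

theorem sum_comp_quadraticChar_ne_zero (h2 : ringChar k ≠ 2) {c : k} (hc : c ≠ 0) (Ψ : ℤ → ℚ) :
    ∑ v : k, (if v = 0 then 0 else Ψ (quadraticChar k (v * c)))
      = ((Fintype.card k : ℚ) - 1) / 2 * (Ψ 1 + Ψ (-1)) := by
  have h0 : (Finset.univ.filter fun v : k => v * c = 0).card = 1 := by
    simp only [mul_eq_zero, hc, or_false, Finset.card_eq_one]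
    exact ⟨0, by ext; simp⟩
  have hs : ∑ v : k, quadraticChar k (v * c) = 0 := by
    simp only [map_mul, ← Finset.sum_mul, quadraticChar_sum_zero h2, zero_mul]
  have hp := two_mul_card_quadraticChar_eq (fun v : k => v * c) (Or.inl rfl)
  have hm := two_mul_card_quadraticChar_eq (fun v : k => v * c) (Or.inr rfl)
  have h := sum_comp_quadraticChar (fun v : k => v * c) Ψ
  rw [h0, hs] at hp hm
  rw [h0] at h
  have hsum : ∑ v : k, (if v = 0 then 0 else Ψ (quadraticChar k (v * c)))
      = ∑ v : k, Ψ (quadraticChar k (v * c)) - Ψ 0 := by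
    have : ∀ v : k, (if v = 0 then 0 else Ψ (quadraticChar k (v * c)))
        = Ψ (quadraticChar k (v * c)) - if v = 0 then Ψ 0 else 0 := by
      intro v
      split_ifs with hv <;> simp [hv]
    rw [Finset.sum_congr rfl fun v _ => this v, Finset.sum_sub_distrib]
    simp only [Finset.sum_ite_eq', Finset.mem_univ, if_true]
  have hp' := congrArg (Int.cast : ℤ → ℚ) hp
  have hm' := congrArg (Int.cast : ℤ → ℚ) hm
  push_cast at hp' hm' h
  rw [hsum, h]
  linear_combination Ψ 1 / 2 * hp' + Ψ (-1) / 2 * hm'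

/-- The joint distribution of the quadratic characters of `v c` and of the discriminant
`t ^ 2 - 4 v c`. -/
theorem sum_comp_quadraticChar_discrim (h2 : ringChar k ≠ 2) {c : k} (hc : c ≠ 0)
    (G : ℤ → ℤ → ℚ) :
    ∑ v : k, (if v = 0 then 0 else
        ∑ t : k, G (quadraticChar k (v * c)) (quadraticChar k (t ^ 2 - 4 * v * c)))
      = ((Fintype.card k : ℚ) - 1) / 2 *
        (2 * G 1 0 + ((Fintype.card k : ℚ) - 3) / 2 * G 1 1
          + ((Fintype.card k : ℚ) - 1) / 2 * G 1 (-1)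
          + ((Fintype.card k : ℚ) - 1) / 2 * G (-1) 1
          + ((Fintype.card k : ℚ) + 1) / 2 * G (-1) (-1)) := by
  have h20 : (2 : k) ≠ 0 := Ring.two_ne_zero h2
  -- Since `4 v c` and `v c` have the same character `α`, the inner sum over `t` is a function of
  -- `α` alone.
  have h := sum_comp_quadraticChar_ne_zero h2 hc fun α =>
    (1 + α) * G α 0 + ((Fintype.card k : ℚ) - 2 - α) / 2 * G α 1
      + ((Fintype.card k : ℚ) - α) / 2 * G α (-1)
  have he : ∀ v : k, (if v = 0 then 0 else
        ∑ t : k, G (quadraticChar k (v * c)) (quadraticChar k (t ^ 2 - 4 * v * c)))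
      = if v = 0 then 0 else
        (1 + (quadraticChar k (v * c) : ℚ)) * G (quadraticChar k (v * c)) 0
        + ((Fintype.card k : ℚ) - 2 - quadraticChar k (v * c)) / 2 * G (quadraticChar k (v * c)) 1
        + ((Fintype.card k : ℚ) - quadraticChar k (v * c)) / 2
          * G (quadraticChar k (v * c)) (-1) := by
    intro v
    split_ifs with hv
    · rfl
    · have e : (4 : k) * v * c = 2 ^ 2 * (v * c) := by ring
      have hw : (4 : k) * v * c ≠ 0 := by
        rw [e]
        exact mul_ne_zero (pow_ne_zero _ h20) (mul_ne_zero hv hc)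
      rw [sum_comp_quadraticChar_sq_sub h2 hw]
      rw [e, map_mul, quadraticChar_sq_one' h20, one_mul]
  rw [Finset.sum_congr rfl fun v _ => he v, h]
  push_cast
  ring

/-- The number of `g` at which the quadratic character of `-v g² + t g - c` is opposite to that of
`c`. -/
def oppositeCard (c v t : k) : ℕ :=
  (Finset.univ.filter fun g : k =>
    quadraticChar k (-v * g ^ 2 + t * g + -c) = -quadraticChar k c).card

theorem quadraticChar_eq_one_or_neg_one {c : k} (hc : c ≠ 0) :
    -quadraticChar k c = 1 ∨ -quadraticChar k c = -1 := by
  rcases quadraticChar_dichotomy hc with h | h <;> simp [h]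


theorem two_mul_oppositeCard_zero_zero {c : k} (hc : c ≠ 0) :
    2 * (oppositeCard c 0 0 : ℤ) = Fintype.card k * (1 - quadraticChar k (-1)) := by
  have h := two_mul_card_quadraticChar_eq (fun g : k => -0 * g ^ 2 + 0 * g + -c)
    (quadraticChar_eq_one_or_neg_one hc)
  rw [oppositeCard, h]
  have e : quadraticChar k (-c) = quadraticChar k (-1) * quadraticChar k c := by
    rw [← map_mul, neg_one_mul]
  have hs := quadraticChar_sq_one hc
  simp only [neg_zero, zero_mul, zero_add, neg_eq_zero, hc, e, Finset.filter_false,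
    Finset.card_empty, Finset.sum_const, Finset.card_univ, nsmul_eq_mul]
  push_cast
  linear_combination -Fintype.card k * quadraticChar k (-1) * hs

theorem two_mul_oppositeCard_zero (h2 : ringChar k ≠ 2) {c t : k} (hc : c ≠ 0) (ht : t ≠ 0) :
    2 * (oppositeCard c 0 t : ℤ) = Fintype.card k - 1 := by
  have hb : Function.Bijective fun g : k => -0 * g ^ 2 + t * g + -c := by
    refine Finite.injective_iff_bijective.mp fun x y hxy => ?_
    simp only [neg_zero, zero_mul, zero_add, add_left_inj] at hxy
    exact mul_left_cancel₀ ht hxy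
  have h := two_mul_card_quadraticChar_eq (fun g : k => -0 * g ^ 2 + t * g + -c)
    (quadraticChar_eq_one_or_neg_one hc)
  have hs : ∑ g : k, quadraticChar k (-0 * g ^ 2 + t * g + -c) = 0 := by
    rw [← quadraticChar_sum_zero h2]
    exact Fintype.sum_bijective _ hb _ _ fun _ => rfl
  have hz : (Finset.univ.filter fun g : k => -0 * g ^ 2 + t * g + -c = 0).card = 1 := by
    have : ∀ g : k, -0 * g ^ 2 + t * g + -c = 0 ↔ g = c / t := by
      intro g
      rw [eq_div_iff ht]
      exact ⟨fun h => by linear_combination h, fun h => by linear_combination h⟩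
    simp only [this, Finset.card_eq_one]
    exact ⟨c / t, by ext; simp⟩
  rw [oppositeCard, h, hs, hz]
  simp

/-- The polynomial `-v g² + t g - c` is truly quadratic here, with discriminant `t² - 4 v c`, so its
root count and its character sum are both known. Multiplying the sum by `-χ c` produces `χ (v c)`.
-/
theorem two_mul_oppositeCard (h2 : ringChar k ≠ 2) {c v : k} (hc : c ≠ 0) (hv : v ≠ 0) (t : k) :
    2 * (oppositeCard c v t : ℤ)
      = Fintype.card k - 1 - quadraticChar k (t ^ 2 - 4 * v * c)
        - quadraticChar k (-1) * quadraticChar k (v * c)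
          * if quadraticChar k (t ^ 2 - 4 * v * c) = 0 then (Fintype.card k : ℤ) - 1 else -1 := by
  have h := two_mul_card_quadraticChar_eq (fun g : k => -v * g ^ 2 + t * g + -c)
    (quadraticChar_eq_one_or_neg_one hc)
  have e : t ^ 2 - 4 * -v * -c = t ^ 2 - 4 * v * c := by ring
  have e' : quadraticChar k (-v) = quadraticChar k (-1) * quadraticChar k v := by
    rw [← map_mul, neg_one_mul]
  rw [card_roots_quadratic h2 (neg_ne_zero.mpr hv), e,
    sum_quadraticChar_quadratic h2 (neg_ne_zero.mpr hv), e, e'] at h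
  rw [oppositeCard, h, map_mul]
  simp only [quadraticChar_eq_zero_iff]
  ring

end QuadraticCharSums

/-! ### Powers in finite fields -/

section PowersInFiniteFields

variable {F : Type*} [Field F] [Fintype F]

/-- In the cyclic group of order `d m` the `d`-th powers lie in the kernel of the `m`-th power map,
and both subgroups have order `m`. -/
theorem exists_pow_eq_of_pow_eq_one {d m : ℕ} (hdm : d * m = Fintype.card F - 1) {x : F}
    (hx : x ^ m = 1) : ∃ y : F, y ≠ 0 ∧ y ^ d = x := by
  have hcard : Nat.card Fˣ = d * m := by
    rw [Nat.card_units, Nat.card_eq_fintype_card, hdm]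
  have hpos : 0 < d * m := hcard ▸ Nat.card_pos
  have hd : 0 < d := Nat.pos_of_mul_pos_right hpos
  have hm : 0 < m := Nat.pos_of_mul_pos_left hpos
  have hx0 : x ≠ 0 := by
    rintro rfl
    rw [zero_pow hm.ne'] at hx
    exact zero_ne_one hx
  have hle : (powMonoidHom d : Fˣ →* Fˣ).range ≤ (powMonoidHom m).ker := by
    rintro _ ⟨u, rfl⟩
    rw [MonoidHom.mem_ker, powMonoidHom_apply, powMonoidHom_apply, ← pow_mul, ← hcard]
    exact pow_card_eq_one'
  have heq : (powMonoidHom d : Fˣ →* Fˣ).range = (powMonoidHom m).ker := by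
    refine Subgroup.eq_of_le_of_card_ge hle ?_
    rw [IsCyclic.card_powMonoidHom_range, IsCyclic.card_powMonoidHom_ker, hcard,
      Nat.gcd_mul_right_left, Nat.gcd_mul_left_left, Nat.mul_div_cancel_left _ hd]
  have hmem : Units.mk0 x hx0 ∈ (powMonoidHom m : Fˣ →* Fˣ).ker := by
    rw [MonoidHom.mem_ker, powMonoidHom_apply]
    exact Units.ext (by simpa using hx)
  rw [← heq] at hmem
  obtain ⟨u, hu⟩ := hmem
  exact ⟨u, u.ne_zero, by simpa using congrArg Units.val hu⟩

/-- All nonempty fibres of `u ↦ u ^ d` over nonzero elements have `d` elements if `d` divides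
`q - 1`. -/
theorem card_pow_eq_pow [DecidableEq F] {d m : ℕ} (hdm : d * m = Fintype.card F - 1) {x : F}
    (hx : x ≠ 0) : (Finset.univ.filter fun u : F => u ^ d = x ^ d).card = d := by
  have hcard : Nat.card Fˣ = d * m := by
    rw [Nat.card_units, Nat.card_eq_fintype_card, hdm]
  have hpos : 0 < d * m := hcard ▸ Nat.card_pos
  have hd : 0 < d := Nat.pos_of_mul_pos_right hpos
  have hk := IsCyclic.card_powMonoidHom_ker Fˣ d
  rw [hcard, Nat.gcd_mul_right_left] at hk
  rw [← Fintype.card_subtype, ← Nat.card_eq_fintype_card]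
  conv_rhs => rw [← hk]
  symm
  refine Nat.card_eq_of_bijective (fun z => ⟨(z.1 : F) * x, ?_⟩) ⟨fun z z' h => ?_, fun u => ?_⟩
  · have hz := z.2
    rw [MonoidHom.mem_ker, powMonoidHom_apply] at hz
    rw [mul_pow, ← Units.val_pow_eq_pow_val, hz, Units.val_one, one_mul]
  · exact Subtype.ext (Units.ext (mul_right_cancel₀ hx (congrArg Subtype.val h)))
  · have hu0 : (u : F) ≠ 0 := by
      intro h0
      have hu := u.2
      rw [h0, zero_pow hd.ne'] at hu
      exact pow_ne_zero d hx hu.symm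
    refine ⟨⟨Units.mk0 (u / x) (div_ne_zero hu0 hx), ?_⟩, Subtype.ext ?_⟩
    · rw [MonoidHom.mem_ker, powMonoidHom_apply]
      refine Units.ext ?_
      rw [Units.val_pow_eq_pow_val, Units.val_mk0, Units.val_one, div_pow, u.2,
        div_self (pow_ne_zero d hx)]
    · simp [div_mul_cancel₀ _ hx]

end PowersInFiniteFields

/-! ### The form `Tr (x ^ (p + 1))`: radical, scaling and level sets -/

section NormTraceForm

theorem sq_sub_one_eq (p : ℕ) : p ^ 2 - 1 = (p + 1) * (p - 1) := by
  simpa using Nat.sq_sub_sq p 1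

variable (p : ℕ) [Fact p.Prime] (F : Type*) [Field F] [Algebra (ZMod p) F]

/-- The quadratic form `x ↦ Tr (x ^ (p + 1))`. -/
noncomputable def normTraceForm : QuadraticForm (ZMod p) F :=
  LinearMap.BilinMap.toQuadraticMap ((Algebra.traceForm (ZMod p) F).compl₁₂
    (FiniteField.frobeniusAlgHom (ZMod p) F).toLinearMap LinearMap.id)

theorem normTraceForm_apply (x : F) :
    normTraceForm p F x = Algebra.trace (ZMod p) F (x ^ (p + 1)) := by
  simp [normTraceForm, pow_succ, ZMod.card]

theorem polar_normTraceForm (x y : F) :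
    QuadraticMap.polar (normTraceForm p F) x y
      = Algebra.trace (ZMod p) F (x ^ p * y) + Algebra.trace (ZMod p) F (y ^ p * x) := by
  simp [normTraceForm, LinearMap.BilinMap.polar_toQuadraticMap, ZMod.card]

theorem normTraceForm_mul {w : F} {a : ZMod p} (hw : w ^ (p + 1) = algebraMap (ZMod p) F a)
    (x : F) : normTraceForm p F (w * x) = a * normTraceForm p F x := by
  rw [normTraceForm_apply, normTraceForm_apply, mul_pow, hw, ← Algebra.smul_def, map_smul,
    smul_eq_mul]

variable [Fintype F]

theorem trace_pow_char (x : F) :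
    Algebra.trace (ZMod p) F (x ^ p) = Algebra.trace (ZMod p) F x := by
  have h := Algebra.trace_eq_of_algEquiv (FiniteField.frobeniusAlgEquivOfAlgebraic (ZMod p) F) x
  simpa [ZMod.card] using h

theorem pow_char_surjective : Function.Surjective fun x : F => x ^ p := by
  have h := (FiniteField.frobeniusAlgEquivOfAlgebraic (ZMod p) F).surjective
  rw [FiniteField.coe_frobeniusAlgEquivOfAlgebraic, ZMod.card] at h
  exact h

/-- The trace is Frobenius invariant, so `Tr (y ^ p * u)` can be raised to the `p`-th power inside.
The polar form then becomes the trace pairing of `y ^ p ^ 2 + y` with `u ^ p`, which ranges over all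
of `F`. -/
theorem mem_ker_polarBilin_normTraceForm (y : F) :
    y ∈ LinearMap.ker (normTraceForm p F).polarBilin ↔ y ^ p ^ 2 = -y := by
  have h : ∀ u : F, (normTraceForm p F).polarBilin y u
      = Algebra.trace (ZMod p) F ((y ^ p ^ 2 + y) * u ^ p) := by
    intro u
    rw [QuadraticMap.polarBilin_apply_apply, polar_normTraceForm, ← trace_pow_char p F (y ^ p * u),
      ← map_add]
    congr 1
    ring
  rw [LinearMap.mem_ker, ← add_eq_zero_iff_eq_neg]
  constructor
  · intro hy
    refine (traceForm_nondegenerate (ZMod p) F).1 _ fun w => ?_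
    obtain ⟨u, rfl⟩ := pow_char_surjective p F w
    rw [Algebra.traceForm_apply, ← h, hy, LinearMap.zero_apply]
  · intro hy
    ext u
    rw [h, hy, zero_mul, map_zero, LinearMap.zero_apply]

theorem exists_algebraMap_eq_of_pow_eq {x : F} (hx : x ^ p = x) :
    ∃ a : ZMod p, algebraMap (ZMod p) F a = x := by
  have : CharP F p := charP_of_injective_algebraMap' (ZMod p) p
  obtain ⟨n, hn⟩ := (mem_bot_iff_intCast p F).mp
    ((Subfield.mem_bot_iff_pow_eq_self F p).mpr hx)
  exact ⟨n, by rw [map_intCast]; exact hn⟩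

variable {p F} {e : ℕ}

/-- The divisor `p ^ 4 - 1` contributes the even cofactor `p ^ 2 + 1`. Evenness is what makes `-1` a
`(p ^ 2 - 1)`-th power, so that the radical is nonzero. -/
theorem exists_card_sub_one_eq (hp : p ≠ 2) (he : 4 ∣ e) :
    ∃ j, p ^ e - 1 = (p ^ 2 - 1) * (2 * j) := by
  obtain ⟨m, rfl⟩ := he
  have hodd : Odd p := (Fact.out : p.Prime).odd_of_ne_two hp
  obtain ⟨a, ha⟩ := hodd
  obtain ⟨b, hb⟩ : p ^ 4 - 1 ∣ p ^ (4 * m) - 1 := by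
    simpa [pow_mul] using Nat.sub_dvd_pow_sub_pow (p ^ 4) 1 m
  -- With `p = 2 a + 1`, the first factor is `(p ^ 2 + 1) / 2`.
  refine ⟨(2 * a ^ 2 + 2 * a + 1) * b, ?_⟩
  have h4 : p ^ 4 - 1 = (p ^ 2 - 1) * (2 * (2 * a ^ 2 + 2 * a + 1)) := by
    have h : 2 * (2 * a ^ 2 + 2 * a + 1) = p ^ 2 + 1 := by
      subst ha
      ring
    have := Nat.sq_sub_sq (p ^ 2) 1
    rw [h, mul_comm, ← this]
    ring_nf
  rw [hb, h4]
  ring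

/-- Nonzero vectors with the same power `u ^ (p ^ 2 - 1)` are simultaneously isotropic. -/
theorem normTraceForm_eq_zero_of_pow_eq {u x : F} (hx : x ≠ 0)
    (h : u ^ (p ^ 2 - 1) = x ^ (p ^ 2 - 1)) (hQ : normTraceForm p F x = 0) :
    normTraceForm p F u = 0 := by
  have hp1 : 1 < p := (Fact.out : p.Prime).one_lt
  have hw : ((u / x) ^ (p + 1)) ^ p = (u / x) ^ (p + 1) := by
    have h1 : ((u / x) ^ (p + 1)) ^ (p - 1) = 1 := by
      rw [← pow_mul, ← sq_sub_one_eq p, div_pow, h, div_self (pow_ne_zero _ hx)]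
    calc ((u / x) ^ (p + 1)) ^ p = ((u / x) ^ (p + 1)) ^ (p - 1 + 1) := by
          rw [Nat.sub_add_cancel hp1.le]
      _ = _ := by rw [pow_succ, h1, one_mul]
  obtain ⟨a, ha⟩ := exists_algebraMap_eq_of_pow_eq p F hw
  have := normTraceForm_mul p F ha.symm x
  rwa [div_mul_cancel₀ _ hx, hQ, mul_zero] at this

section

variable (hp : p ≠ 2) (he : 4 ∣ e) (hF : Fintype.card F = p ^ e)
include hp he hF

/-- The nonzero radical vectors are the solutions of `u ^ (p ^ 2 - 1) = -1`: a nonempty fibre of a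
power map, hence `p ^ 2 - 1` elements. -/
theorem card_ker_polarBilin_normTraceForm :
    Nat.card (LinearMap.ker (normTraceForm p F).polarBilin) = p ^ 2 := by
  classical
  have hp1 : 1 < p := (Fact.out : p.Prime).one_lt
  have hp2 : 1 < p ^ 2 := Nat.one_lt_pow two_ne_zero hp1
  obtain ⟨j, hj⟩ := exists_card_sub_one_eq (p := p) hp he
  rw [← hF] at hj
  obtain ⟨y, hy0, hy⟩ := exists_pow_eq_of_pow_eq_one hj.symm (x := (-1 : F)) (by simp)
  have hset : (Finset.univ.filter fun u : F => u ∈ LinearMap.ker (normTraceForm p F).polarBilin)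
      = insert 0 (Finset.univ.filter fun u : F => u ^ (p ^ 2 - 1) = y ^ (p ^ 2 - 1)) := by
    ext u
    simp only [Finset.mem_filter, Finset.mem_univ, true_and, Finset.mem_insert,
      mem_ker_polarBilin_normTraceForm, hy]
    by_cases hu : u = 0
    · simp [hu, (Fact.out : p.Prime).ne_zero]
    · have : u ^ p ^ 2 = u ^ (p ^ 2 - 1) * u := by rw [← pow_succ, Nat.sub_add_cancel hp2.le]
      rw [or_iff_right hu, this, ← neg_one_mul u, mul_left_inj' hu]
  rw [Nat.card_eq_fintype_card, Fintype.card_subtype, hset, Finset.card_insert_of_notMem,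
    card_pow_eq_pow hj.symm hy0, Nat.sub_add_cancel hp2.le]
  simp [hy, (Nat.sub_pos_of_lt hp2).ne']

/-- Every nonzero `a` in the prime field is some `w ^ (p + 1)`, and multiplication by `w` scales the
form by `a`. -/
theorem levelCard_normTraceForm_mul {a : ZMod p} (ha : a ≠ 0) (s : ZMod p) :
    levelCard (normTraceForm p F) (a * s) = levelCard (normTraceForm p F) s := by
  obtain ⟨j, hj⟩ := exists_card_sub_one_eq (p := p) hp he
  obtain ⟨w, hw0, hw⟩ : ∃ w : F, w ≠ 0 ∧ w ^ (p + 1) = algebraMap (ZMod p) F a := by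
    refine exists_pow_eq_of_pow_eq_one (m := (p - 1) * (2 * j)) ?_ ?_
    · rw [hF, hj, sq_sub_one_eq p, mul_assoc]
    · rw [pow_mul, ← map_pow, ZMod.pow_card_sub_one_eq_one ha, map_one, one_pow]
  symm
  refine Finset.card_bijective (fun u => w * u) (mulLeft_bijective₀ w hw0) fun u => ?_
  simp [normTraceForm_mul p F hw, ha]

/-- The nonzero isotropic vectors form a union of fibres of `u ↦ u ^ (p ^ 2 - 1)`, each with `p ^ 2
- 1` elements. -/
theorem sq_sub_one_dvd_levelCard_zero :
    p ^ 2 - 1 ∣ levelCard (normTraceForm p F) 0 - 1 := by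
  classical
  obtain ⟨j, hj⟩ := exists_card_sub_one_eq (p := p) hp he
  rw [← hF] at hj
  have h0 : (0 : F) ∈ Finset.univ.filter fun u : F => normTraceForm p F u = 0 := by simp
  rw [levelCard, ← Finset.card_erase_of_mem h0, Finset.card_eq_sum_card_image
    (fun u : F => u ^ (p ^ 2 - 1))]
  refine Finset.dvd_sum fun b hb => ?_
  obtain ⟨x, hx, rfl⟩ := Finset.mem_image.mp hb
  simp only [Finset.mem_erase, Finset.mem_filter, Finset.mem_univ, true_and] at hx
  refine (dvd_of_eq (card_pow_eq_pow hj.symm hx.1).symm).trans (dvd_of_eq ?_)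
  congr 1
  ext u
  simp only [Finset.mem_erase, Finset.mem_filter, Finset.mem_univ, true_and, ne_eq]
  have hp2 : 1 < p ^ 2 := Nat.one_lt_pow two_ne_zero (Fact.out : p.Prime).one_lt
  refine ⟨fun h => ⟨⟨?_, normTraceForm_eq_zero_of_pow_eq hx.1 h hx.2⟩, h⟩, fun h => h.2⟩
  rintro rfl
  rw [zero_pow (Nat.sub_pos_of_lt hp2).ne'] at h
  exact pow_ne_zero _ hx.1 h.symm

/-- The level sets of `x ↦ Tr (x ^ (p + 1))`. -/
theorem mul_levelCard_normTraceForm (s : ZMod p) :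
    (p : ℤ) * levelCard (normTraceForm p F) s
      = (p : ℤ) ^ e + (p : ℤ) ^ (e / 2 + 1) * (1 - if s = 0 then (p : ℤ) else 0) := by
  have hpp : p.Prime := Fact.out
  have hp3 : 3 ≤ p := by have := hpp.two_le; omega
  set Q := normTraceForm p F
  have hconst : ∀ s : ZMod p, s ≠ 0 → levelCard Q s = levelCard Q 1 := by
    intro s hs
    simpa using levelCard_normTraceForm_mul hp he hF hs 1
  have hsum := sum_levelCard Q
  have hsq := card_mul_sum_levelCard_sq Q (Ring.two_ne_zero (by rwa [ZMod.ringChar_zmod_n]))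
  rw [card_ker_polarBilin_normTraceForm hp he hF, hF, ZMod.card] at hsq
  rw [hF] at hsum
  have hsplit : ∀ f : ℕ → ℤ, ∑ s, f (levelCard Q s)
      = f (levelCard Q 0) + (p - 1) * f (levelCard Q 1) := by
    intro f
    have : ∀ s, f (levelCard Q s) = f (levelCard Q 1)
        + if s = 0 then f (levelCard Q 0) - f (levelCard Q 1) else 0 := by
      intro s
      split_ifs with h
      · rw [h]; ring
      · rw [hconst s h]; ring
    rw [Finset.sum_congr rfl fun s _ => this s, Finset.sum_add_distrib]
    simp [ZMod.card]
    ring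
  have h1 := hsplit fun n => (n : ℤ)
  have h2 := hsplit fun n => (n : ℤ) ^ 2
  have hsum' : ∑ s, (levelCard Q s : ℤ) = (p : ℤ) ^ e := by exact_mod_cast hsum
  rw [hsum'] at h1
  rw [h2] at hsq
  obtain ⟨c, hc⟩ : p ^ 2 - 1 ∣ levelCard Q 0 - 1 := sq_sub_one_dvd_levelCard_zero hp he hF
  have hpos : 0 < levelCard Q 0 := Finset.card_pos.mpr ⟨0, by simp⟩
  have hc' : (levelCard Q 0 : ℤ) = 1 + ((p : ℤ) ^ 2 - 1) * c := by
    have hle : 1 ≤ p ^ 2 := Nat.one_le_pow _ _ hpp.pos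
    have : levelCard Q 0 = 1 + (p ^ 2 - 1) * c := by rw [← hc]; omega
    rw [this]
    push_cast [hle]
    ring
  obtain ⟨m, rfl⟩ := he
  have hhalf : 4 * m / 2 = 2 * m := by omega
  rw [hhalf]
  push_cast at hsq
  generalize hA0 : (levelCard Q 0 : ℤ) = A at *
  generalize hB : (levelCard Q 1 : ℤ) = B at *
  have hp0 : (p : ℤ) ≠ 0 := by exact_mod_cast hpp.ne_zero
  have hp3' : (3 : ℤ) ≤ p := by exact_mod_cast hp3
  have hS : (A - B) ^ 2 = ((p : ℤ) ^ (2 * m + 1)) ^ 2 := by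
    have hq : (p : ℤ) ^ (4 * m) = A + (p - 1) * B := h1
    have e1 : ((p : ℤ) ^ (2 * m + 1)) ^ 2 = (p : ℤ) ^ (4 * m) * p ^ 2 := by ring
    rw [e1]
    have e2 : ((p : ℤ) - 1) * (A - B) ^ 2 = (p - 1) * ((p : ℤ) ^ (4 * m) * p ^ 2) := by
      rw [hq] at hsq ⊢
      linear_combination hsq
    exact mul_left_cancel₀ (by omega) e2
  -- Modulo `p ^ 2 - 1` both `A` and `p ^ (2 * m)` are `1`. The positive sign would force `p ^ 2 - 1
  -- ∣ 2 (p - 1)`, impossible for `p ≥ 3`.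
  have hneg : A - B = -(p : ℤ) ^ (2 * m + 1) := by
    rcases sq_eq_sq_iff_eq_or_eq_neg.mp hS with h | h
    · exfalso
      obtain ⟨d, hd⟩ : ((p : ℤ) ^ 2 - 1) ∣ (p : ℤ) ^ (2 * m) - 1 := by
        simpa [pow_mul] using sub_dvd_pow_sub_pow ((p : ℤ) ^ 2) 1 m
      have e4 : (p : ℤ) ^ (4 * m) = ((p : ℤ) ^ (2 * m)) ^ 2 := by ring
      have e5 : (p : ℤ) ^ (2 * m + 1) = (p : ℤ) ^ (2 * m) * p := by ring
      have hX : (p : ℤ) ^ (2 * m) = 1 + (p ^ 2 - 1) * d := by linear_combination hd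
      have hA : p * A = (p : ℤ) ^ (4 * m) + (p - 1) * (A - B) := by linear_combination -h1
      rw [h, e4, e5, hX, hc'] at hA
      have hdvd : ((p : ℤ) ^ 2 - 1) ∣ 2 * ((p : ℤ) - 1) := by
        refine ⟨1 - p * c + (2 * d + ((p : ℤ) ^ 2 - 1) * d ^ 2) + ((p : ℤ) - 1) * p * d, ?_⟩
        linear_combination hA
      have := Int.le_of_dvd (by linarith) hdvd
      nlinarith
    · exact h
  split_ifs with hs
  · rw [hs, hA0]
    linear_combination -h1 + ((p : ℤ) - 1) * hneg
  · rw [hconst s hs, hB]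
    linear_combination -h1 - hneg

end

end NormTraceForm

/-! ### Weights of linear forms on the opposite set -/

section WeightsOfForms

variable {p : ℕ} [Fact p.Prime] {V : Type*} [AddCommGroup V] [Module (ZMod p) V] [Fintype V]

/-- The translate by `y` of the set on which the quadratic character of `Q u - Q y` is opposite to
that of `Q y`. -/
def oppositeSet (Q : QuadraticForm (ZMod p) V) (y : V) : Finset V :=
  Finset.univ.filter fun x =>
    quadraticChar (ZMod p) (Q (x - y) - Q y) = -quadraticChar (ZMod p) (Q y)

open Classical in
/-- The number of points of `oppositeSet Q y` at which a linear form does not vanish. -/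
noncomputable def formWeight (Q : QuadraticForm (ZMod p) V) (y : V)
    (l : Module.Dual (ZMod p) V) : ℕ :=
  ((oppositeSet Q y).filter fun x => l x ≠ 0).card

theorem ringChar_zmod_ne_two (hp : p ≠ 2) : ringChar (ZMod p) ≠ 2 := by
  rwa [ZMod.ringChar_zmod_n]

theorem card_oppositeSet_filter (Q : QuadraticForm (ZMod p) V) (y : V)
    (l : Module.Dual (ZMod p) V) :
    ((oppositeSet Q y).filter fun x => l x = 0).card
      = (Finset.univ.filter fun u : V =>
          quadraticChar (ZMod p) (Q u - Q y) = -quadraticChar (ZMod p) (Q y) ∧ l u = -l y).card := by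
  refine Finset.card_equiv (Equiv.subRight y) fun x => ?_
  simp [oppositeSet, sub_eq_neg_self, -neg_inj]

theorem formWeight_eq (Q : QuadraticForm (ZMod p) V) (y : V) (l : Module.Dual (ZMod p) V) :
    (formWeight Q y l : ℤ) = (oppositeSet Q y).card
      - (Finset.univ.filter fun u : V =>
          quadraticChar (ZMod p) (Q u - Q y) = -quadraticChar (ZMod p) (Q y) ∧ l u = -l y).card := by
  classical
  rw [← card_oppositeSet_filter, eq_sub_iff_add_eq, add_comm, formWeight]
  have := Finset.card_filter_add_card_filter_not (s := oppositeSet Q y) (fun x => l x = 0)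
  exact_mod_cast this

/-- A linear form that does not vanish on the radical takes each value equally often. -/
theorem mul_formWeight_of_ker (Q : QuadraticForm (ZMod p) V) (hp : p ≠ 2) (y : V)
    {l : Module.Dual (ZMod p) V} {x : V} (hx : x ∈ LinearMap.ker Q.polarBilin) (hl : l x ≠ 0) :
    (p : ℤ) * formWeight Q y l = (p - 1) * (oppositeSet Q y).card := by
  have hx' : ∀ u, QuadraticMap.polar Q x u = 0 := fun u => by
    rw [← QuadraticMap.polarBilin_apply_apply, LinearMap.mem_ker.mp hx, LinearMap.zero_apply]
  have hQ : Q x = 0 := by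
    have h := QuadraticMap.polar_self Q x
    rw [hx', two_smul, ← two_mul] at h
    exact (mul_eq_zero.mp h.symm).resolve_left (Ring.two_ne_zero (ringChar_zmod_ne_two hp))
  have h := card_mul_card_fiber_of_invariant
    (fun u : V => quadraticChar (ZMod p) (Q u - Q y) = -quadraticChar (ZMod p) (Q y)) x
    (fun t u => by rw [map_add_smul, hx', hQ]; simp) l hl (-l y)
  have hD : (oppositeSet Q y).card = (Finset.univ.filter fun u : V =>
      quadraticChar (ZMod p) (Q u - Q y) = -quadraticChar (ZMod p) (Q y)).card := by
    refine Finset.card_equiv (Equiv.subRight y) fun x => ?_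
    simp [oppositeSet]
  rw [ZMod.card, ← hD] at h
  rw [formWeight_eq, mul_sub, sub_mul, one_mul]
  congr 1
  exact_mod_cast h

variable (Q : QuadraticForm (ZMod p) V) (y : V) (Z : ℤ)

/-- The number of `s` with the quadratic character of `s - c` opposite to that of `c`. -/
theorem two_mul_card_opposite (hp : p ≠ 2) {c : ZMod p} (hc : c ≠ 0) :
    2 * ((Finset.univ.filter fun s : ZMod p =>
      quadraticChar (ZMod p) (s - c) = -quadraticChar (ZMod p) c).card : ℤ) = p - 1 := by
  have h := two_mul_card_quadraticChar_eq (fun s : ZMod p => s - c)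
    (quadraticChar_eq_one_or_neg_one hc)
  have hs : ∑ s : ZMod p, quadraticChar (ZMod p) (s - c) = 0 := by
    rw [← quadraticChar_sum_zero (ringChar_zmod_ne_two hp)]
    exact Equiv.sum_comp (Equiv.subRight c) _
  have hz : (Finset.univ.filter fun s : ZMod p => s - c = 0).card = 1 :=
    Finset.card_eq_one.mpr ⟨c, by ext; simp [sub_eq_zero]⟩
  rw [h, hs, hz, ZMod.card]
  simp

section

variable (hp : p ≠ 2)
  (hN : ∀ s, (levelCard Q s : ℤ) = Z ^ 2 * p ^ 3 + Z * p ^ 2 * (1 - if s = 0 then (p : ℤ) else 0))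
include hp hN

/-- In the application `Z = p ^ (e / 2 - 2)`. All levels of `Q` have the same size except the zero
level, smaller by `Z p³`; the latter is counted exactly when `χ (-c) = -χ c`, that is when `χ (-1) =
-1`. -/
theorem card_oppositeSet (hy : Q y ≠ 0) :
    2 * ((oppositeSet Q y).card : ℤ)
      = (p - 1) * (Z ^ 2 * p ^ 3 + Z * p ^ 2)
        - Z * p ^ 3 * (1 - quadraticChar (ZMod p) (-1)) := by
  set c := Q y with hc
  have h1 : ((oppositeSet Q y).card : ℤ)
      = ∑ s : ZMod p, if quadraticChar (ZMod p) (s - c) = -quadraticChar (ZMod p) c then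
          (levelCard Q s : ℤ) else 0 := by
    have hD : (oppositeSet Q y).card = (Finset.univ.filter fun u : V =>
        quadraticChar (ZMod p) (Q u - c) = -quadraticChar (ZMod p) c).card := by
      refine Finset.card_equiv (Equiv.subRight y) fun x => ?_
      simp [oppositeSet, hc]
    rw [hD, Finset.card_eq_sum_card_fiberwise (f := Q) (t := Finset.univ)
      (fun _ _ => Finset.mem_univ _)]
    push_cast
    refine Finset.sum_congr rfl fun s _ => ?_
    rw [Finset.filter_filter, levelCard]
    split_ifs with hs
    · congr 2
      ext u
      simp only [Finset.mem_filter, Finset.mem_univ, true_and, and_iff_right_iff_imp]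
      rintro rfl
      exact hs
    · rw [Nat.cast_eq_zero, Finset.card_eq_zero, Finset.filter_eq_empty_iff]
      rintro u - ⟨h, rfl⟩
      exact hs h
  have h2 : ∀ s : ZMod p, (if quadraticChar (ZMod p) (s - c) = -quadraticChar (ZMod p) c then
        (levelCard Q s : ℤ) else 0)
      = (Z ^ 2 * p ^ 3 + Z * p ^ 2)
          * (if quadraticChar (ZMod p) (s - c) = -quadraticChar (ZMod p) c then 1 else 0)
        - if s = 0 then
          (if quadraticChar (ZMod p) (-c) = -quadraticChar (ZMod p) c then Z * p ^ 3 else 0)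
          else 0 := by
    intro s
    rw [hN]
    by_cases hs : s = 0
    · subst hs
      simp only [zero_sub, if_true]
      split_ifs <;> ring
    · simp only [hs, if_false]
      split_ifs <;> ring
  have h3 : (2 : ℤ) * (if quadraticChar (ZMod p) (-c) = -quadraticChar (ZMod p) c then
      Z * p ^ 3 else 0) = Z * p ^ 3 * (1 - quadraticChar (ZMod p) (-1)) := by
    have e : quadraticChar (ZMod p) (-c)
        = quadraticChar (ZMod p) (-1) * quadraticChar (ZMod p) c := by
      rw [← map_mul, neg_one_mul]
    rw [e]
    rcases quadraticChar_dichotomy (neg_ne_zero.mpr (one_ne_zero (α := ZMod p))) with h | h <;>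
      rcases quadraticChar_dichotomy hy with h' | h' <;> rw [h, h'] <;> norm_num <;> ring
  rw [h1, Finset.sum_congr rfl fun s _ => h2 s, Finset.sum_sub_distrib, ← Finset.mul_sum,
    Finset.sum_ite_eq', if_pos (Finset.mem_univ _), mul_sub, h3, ← Finset.natCast_card_filter]
  linear_combination (Z ^ 2 * p ^ 3 + Z * p ^ 2) * two_mul_card_opposite hp hy

omit hp in
-- Only the zero level has a special size, so the sum over translates sees just the number of roots
-- of a polynomial in `t`.
theorem card_level_inter (hV : (Fintype.card V : ℤ) = Z ^ 2 * p ^ 4) {x : V}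
    (hx : Q.polarBilin x ≠ 0) (s r : ZMod p) :
    ((Finset.univ.filter fun u => Q u = s ∧ QuadraticMap.polar Q x u = r).card : ℤ)
      = Z ^ 2 * p ^ 2 + Z * p ^ 2
        * (1 - (Finset.univ.filter fun t : ZMod p => s + t * r + t ^ 2 * Q x = 0).card) := by
  have h := card_mul_card_level_inter Q x hx s r
  have hs : ∀ t : ZMod p, (levelCard Q (s + t * r + t ^ 2 * Q x) : ℤ)
      = Z ^ 2 * p ^ 3 + Z * p ^ 2
        - Z * p ^ 3 * if s + t * r + t ^ 2 * Q x = 0 then 1 else 0 := by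
    intro t
    rw [hN]
    split_ifs <;> ring
  rw [Finset.sum_congr rfl fun t _ => hs t, Finset.sum_sub_distrib, ← Finset.mul_sum,
    ← Finset.natCast_card_filter, hV, Finset.sum_const, Finset.card_univ, ZMod.card,
    nsmul_eq_mul] at h
  have hp0 : (p : ℤ) ≠ 0 := by exact_mod_cast (Fact.out : p.Prime).ne_zero
  refine mul_left_cancel₀ hp0 (mul_left_cancel₀ hp0 ?_)
  rw [h]
  ring

theorem two_mul_formWeight_polarBilin (hV : (Fintype.card V : ℤ) = Z ^ 2 * p ^ 4)
    (hy : Q y ≠ 0) {x : V} (hx : Q.polarBilin x ≠ 0) :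
    2 * (formWeight Q y (Q.polarBilin x) : ℤ)
      = (p - 1) ^ 2 * Z ^ 2 * p ^ 2
        + Z * p ^ 2 * (2 * oppositeCard (Q y) (Q x) (QuadraticMap.polar Q x y)
          - p * (1 - quadraticChar (ZMod p) (-1))) := by
  set c := Q y with hc
  set t := QuadraticMap.polar Q x y with ht
  have h1 : ((Finset.univ.filter fun u : V =>
        quadraticChar (ZMod p) (Q u - c) = -quadraticChar (ZMod p) c
          ∧ Q.polarBilin x u = -Q.polarBilin x y).card : ℤ)
      = ∑ s : ZMod p, if quadraticChar (ZMod p) (s - c) = -quadraticChar (ZMod p) c then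
          ((Finset.univ.filter fun u => Q u = s ∧ QuadraticMap.polar Q x u = -t).card : ℤ)
          else 0 := by
    rw [Finset.card_eq_sum_card_fiberwise (f := Q) (t := Finset.univ)
      (fun _ _ => Finset.mem_univ _)]
    push_cast
    refine Finset.sum_congr rfl fun s _ => ?_
    rw [Finset.filter_filter]
    simp only [QuadraticMap.polarBilin_apply_apply, ← ht]
    split_ifs with hs
    · congr 2
      ext u
      simp only [Finset.mem_filter, Finset.mem_univ, true_and]
      constructor
      · rintro ⟨⟨-, h⟩, h'⟩
        exact ⟨h', h⟩
      · rintro ⟨rfl, h⟩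
        exact ⟨⟨hs, h⟩, rfl⟩
    · rw [Nat.cast_eq_zero, Finset.card_eq_zero, Finset.filter_eq_empty_iff]
      rintro u - ⟨⟨h, -⟩, rfl⟩
      exact hs h
  -- Each `g` is a root for exactly one `s`, namely `s = -Q x g² + t g`; exchanging the roles of `s`
  -- and `g` leaves `oppositeCard`.
  have h2 : ∑ s : ZMod p, (if quadraticChar (ZMod p) (s - c) = -quadraticChar (ZMod p) c then
      ((Finset.univ.filter fun g : ZMod p => s + g * -t + g ^ 2 * Q x = 0).card : ℤ) else 0)
      = oppositeCard c (Q x) t := by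
    rw [oppositeCard, Finset.card_eq_sum_card_fiberwise (f := fun g => -Q x * g ^ 2 + t * g)
      (t := Finset.univ) (fun _ _ => Finset.mem_univ _)]
    push_cast
    refine Finset.sum_congr rfl fun s _ => ?_
    rw [Finset.filter_filter]
    have he : ∀ g : ZMod p, s + g * -t + g ^ 2 * Q x = 0 ↔ -Q x * g ^ 2 + t * g = s := fun g =>
      ⟨fun h => by linear_combination -h, fun h => by linear_combination -h⟩
    simp only [he]
    split_ifs with hs
    · congr 2
      ext g
      simp only [Finset.mem_filter, Finset.mem_univ, true_and]
      constructor
      · rintro rfl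
        exact ⟨by rwa [← sub_eq_add_neg], rfl⟩
      · exact fun h => h.2
    · symm
      rw [Nat.cast_eq_zero, Finset.card_eq_zero, Finset.filter_eq_empty_iff]
      rintro g - ⟨h, rfl⟩
      exact hs (by rwa [sub_eq_add_neg])
  have h3 : ∀ s : ZMod p, (if quadraticChar (ZMod p) (s - c) = -quadraticChar (ZMod p) c then
        ((Finset.univ.filter fun u => Q u = s ∧ QuadraticMap.polar Q x u = -t).card : ℤ) else 0)
      = (Z ^ 2 * p ^ 2 + Z * p ^ 2)
          * (if quadraticChar (ZMod p) (s - c) = -quadraticChar (ZMod p) c then 1 else 0)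
        - Z * p ^ 2 * if quadraticChar (ZMod p) (s - c) = -quadraticChar (ZMod p) c then
          ((Finset.univ.filter fun g : ZMod p => s + g * -t + g ^ 2 * Q x = 0).card : ℤ)
          else 0 := by
    intro s
    rw [card_level_inter Q Z hN hV hx]
    split_ifs <;> ring
  rw [formWeight_eq, h1, Finset.sum_congr rfl fun s _ => h3 s, Finset.sum_sub_distrib,
    ← Finset.mul_sum, ← Finset.mul_sum, h2, ← Finset.natCast_card_filter]
  linear_combination card_oppositeSet Q y Z hp hN hy
    - (Z ^ 2 * p ^ 2 + Z * p ^ 2) * two_mul_card_opposite hp hy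

/-- The number of vectors with prescribed values of `Q` and of the linear form `polar Q y`. -/
theorem card_level_inter_eq_quadraticChar (hV : (Fintype.card V : ℤ) = Z ^ 2 * p ^ 4)
    (hy : Q y ≠ 0) (v t : ZMod p) :
    ((Finset.univ.filter fun u => Q u = v ∧ QuadraticMap.polar Q u y = t).card : ℤ)
      = p ^ 2 * (Z ^ 2 - Z * quadraticChar (ZMod p) (t ^ 2 - 4 * v * Q y)) := by
  have h20 : (2 : ZMod p) ≠ 0 := Ring.two_ne_zero (ringChar_zmod_ne_two hp)
  have hx : Q.polarBilin y ≠ 0 := by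
    intro h
    have h' := QuadraticMap.polar_self Q y
    rw [← QuadraticMap.polarBilin_apply_apply, h, LinearMap.zero_apply, two_smul,
      ← two_mul] at h'
    exact hy ((mul_eq_zero.mp h'.symm).resolve_left h20)
  simp only [QuadraticMap.polar_comm Q _ y]
  have he : ∀ g : ZMod p, v + g * t + g ^ 2 * Q y = Q y * g ^ 2 + t * g + v := fun g => by ring
  rw [card_level_inter Q Z hN hV hx]
  simp only [he]
  rw [card_roots_quadratic (ringChar_zmod_ne_two hp) hy, mul_right_comm 4 (Q y) v]
  ring

end

end WeightsOfForms

/-! ### Sums over the range of a linear map -/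

section SumOverRange

variable {k A B : Type*} [Ring k] [AddCommGroup A] [AddCommGroup B] [Module k A] [Module k B]
  [Fintype A] [Fintype B]

open Classical in
theorem sum_comp_linearMap (f : A →ₗ[k] B) (h : B → ℚ) :
    ∑ x, h (f x) = Nat.card (LinearMap.ker f) * ∑ b, if b ∈ LinearMap.range f then h b else 0 := by
  rw [← Finset.sum_fiberwise' Finset.univ f h, Finset.mul_sum]
  refine Finset.sum_congr rfl fun b _ => ?_
  rw [Finset.sum_const, nsmul_eq_mul]
  split_ifs with hb
  · obtain ⟨x, rfl⟩ := hb
    congr 2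
    rw [Nat.card_eq_fintype_card, Fintype.card_subtype]
    refine Finset.card_equiv (Equiv.subRight x) fun u => ?_
    simp [sub_eq_zero]
  · rw [mul_zero, Finset.filter_eq_empty_iff.mpr, Finset.card_empty, Nat.cast_zero, zero_mul]
    rintro x - rfl
    exact hb ⟨x, rfl⟩

end SumOverRange

/-! ### The weight enumerator -/

section WeightEnumerator

variable {p : ℕ} [Fact p.Prime] {V : Type*} [AddCommGroup V] [Module (ZMod p) V] [Fintype V]
  (Q : QuadraticForm (ZMod p) V) (y : V) (Z : ℤ) (hp : p ≠ 2)
  (hN : ∀ s, (levelCard Q s : ℤ) = Z ^ 2 * p ^ 3 + Z * p ^ 2 * (1 - if s = 0 then (p : ℤ) else 0))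
  (hV : (Fintype.card V : ℤ) = Z ^ 2 * p ^ 4)
  (hK : Nat.card (LinearMap.ker Q.polarBilin) = p ^ 2) (hy : Q y ≠ 0)
include hp hN hV hy

theorem formWeight_of_mem_range {x : V} (hx : Q.polarBilin x ≠ 0) :
    (formWeight Q y (Q.polarBilin x) : ℚ)
      = (p - 1) ^ 2 / 2 * (Z ^ 2 * p ^ 2)
        + Z * p ^ 2 * (oppositeCard (Q y) (Q x) (QuadraticMap.polar Q x y)
          - p * (1 - quadraticChar (ZMod p) (-1)) / 2) := by
  have h := congrArg (Int.cast : ℤ → ℚ) (two_mul_formWeight_polarBilin Q y Z hp hN hV hy hx)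
  push_cast at h
  linear_combination h / 2

omit hV in
theorem formWeight_of_notMem_range {l : Module.Dual (ZMod p) V}
    (hl : l ∉ LinearMap.range Q.polarBilin) :
    (formWeight Q y l : ℚ)
      = (p - 1) / 2 * ((p - 1) * (Z ^ 2 * p ^ 2 + Z * p)
          - Z * p ^ 2 * (1 - quadraticChar (ZMod p) (-1))) := by
  obtain ⟨x, hx, hlx⟩ : ∃ x ∈ LinearMap.ker Q.polarBilin, l x ≠ 0 := by
    by_contra! h
    exact hl (exists_polarBilin_eq Q l h)
  have h1 := congrArg (Int.cast : ℤ → ℚ) (mul_formWeight_of_ker Q hp y hx hlx)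
  have h2 := congrArg (Int.cast : ℤ → ℚ) (card_oppositeSet Q y Z hp hN hy)
  have hp0 : (p : ℚ) ≠ 0 := by exact_mod_cast (Fact.out : p.Prime).ne_zero
  push_cast at h1 h2
  refine mul_left_cancel₀ hp0 ?_
  linear_combination h1 + (p - 1) / 2 * h2

include hK

/-- The weight enumerator in terms of the joint distribution of a quadratic and a linear form. -/
theorem sum_comp_formWeight [Fintype (Module.Dual (ZMod p) V)] (g : ℚ → ℚ) (W : ℕ → ℚ)
    (hW : ∀ R, W R = (p - 1) ^ 2 / 2 * (Z ^ 2 * p ^ 2)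
        + Z * p ^ 2 * (R - p * (1 - quadraticChar (ZMod p) (-1)) / 2)) :
    ∑ l : Module.Dual (ZMod p) V, g (formWeight Q y l)
      = g 0 + (Z ^ 2 * p ^ 4 - Z ^ 2 * p ^ 2) * g ((p - 1) / 2 * ((p - 1) * (Z ^ 2 * p ^ 2 + Z * p)
          - Z * p ^ 2 * (1 - quadraticChar (ZMod p) (-1))))
        - g (W (oppositeCard (Q y) 0 0))
        + ∑ v : ZMod p, ∑ t : ZMod p,
          (Z ^ 2 - Z * quadraticChar (ZMod p) (t ^ 2 - 4 * v * Q y))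
            * g (W (oppositeCard (Q y) v t)) := by
  classical
  have hp0 : (p : ℚ) ≠ 0 := by exact_mod_cast (Fact.out : p.Prime).ne_zero
  have hp2 : (p : ℚ) ^ 2 ≠ 0 := pow_ne_zero 2 hp0
  have hVq : (Fintype.card V : ℚ) = Z ^ 2 * p ^ 4 := by exact_mod_cast hV
  have hdual : (Fintype.card (Module.Dual (ZMod p) V) : ℚ) = Z ^ 2 * p ^ 4 := by
    rw [← hVq]
    exact_mod_cast Fintype.card_congr
      (LinearEquiv.ofFinrankEq (Module.Dual (ZMod p) V) V Subspace.dual_finrank_eq).toEquiv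
  have hrange := sum_comp_linearMap Q.polarBilin fun _ => 1
  have hsum := sum_comp_linearMap Q.polarBilin fun l => g (formWeight Q y l)
  rw [hK] at hrange hsum
  set wu : ℚ := (p - 1) / 2 * ((p - 1) * (Z ^ 2 * p ^ 2 + Z * p)
          - Z * p ^ 2 * (1 - quadraticChar (ZMod p) (-1))) with hwu
  have hsplit : ∑ l : Module.Dual (ZMod p) V, g (formWeight Q y l)
      = (∑ l, if l ∈ LinearMap.range Q.polarBilin then g (formWeight Q y l) else 0)
        + (Z ^ 2 * p ^ 4 - ∑ l, if l ∈ LinearMap.range Q.polarBilin then 1 else 0) * g wu := by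
    have : ∀ l, g (formWeight Q y l)
        = (if l ∈ LinearMap.range Q.polarBilin then g (formWeight Q y l) else 0)
          + (1 - if l ∈ LinearMap.range Q.polarBilin then 1 else 0) * g wu := by
      intro l
      split_ifs with hl
      · ring
      · rw [formWeight_of_notMem_range Q y Z hp hN hy hl, hwu]
        ring
    rw [Finset.sum_congr rfl fun l _ => this l, Finset.sum_add_distrib, ← Finset.sum_mul,
      Finset.sum_sub_distrib, ← hdual]
    simp
  have hker : ((Finset.univ.filter fun x => Q.polarBilin x = 0).card : ℚ) = p ^ 2 := by
    rw [Nat.card_eq_fintype_card, Fintype.card_subtype] at hK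
    simp only [LinearMap.mem_ker] at hK
    exact_mod_cast hK
  -- A radical vector gives the zero form, of weight `0`. The general formula would give it the
  -- weight for `v = t = 0`, hence the correction.
  have hterm : ∀ x, g (formWeight Q y (Q.polarBilin x))
      = g (W (oppositeCard (Q y) (Q x) (QuadraticMap.polar Q x y)))
        + (if Q.polarBilin x = 0 then 1 else 0) * (g 0 - g (W (oppositeCard (Q y) 0 0))) := by
    intro x
    split_ifs with hx
    · have hpol : ∀ u, QuadraticMap.polar Q x u = 0 := fun u => by
        rw [← QuadraticMap.polarBilin_apply_apply, hx, LinearMap.zero_apply]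
      have hQ : Q x = 0 := by
        have h := QuadraticMap.polar_self Q x
        rw [hpol, two_smul, ← two_mul] at h
        exact (mul_eq_zero.mp h.symm).resolve_left (Ring.two_ne_zero (ringChar_zmod_ne_two hp))
      have h0 : formWeight Q y (0 : Module.Dual (ZMod p) V) = 0 := by simp [formWeight]
      rw [hx, hpol, hQ, h0]
      push_cast
      ring
    · rw [formWeight_of_mem_range Q y Z hp hN hV hy hx, hW]
      ring
  have hjoint : ∑ x, g (W (oppositeCard (Q y) (Q x) (QuadraticMap.polar Q x y)))
      = p ^ 2 * ∑ v : ZMod p, ∑ t : ZMod p,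
          (Z ^ 2 - Z * quadraticChar (ZMod p) (t ^ 2 - 4 * v * Q y))
            * g (W (oppositeCard (Q y) v t)) := by
    rw [← Finset.sum_fiberwise' Finset.univ (fun x => (Q x, QuadraticMap.polar Q x y))
      (fun a : ZMod p × ZMod p => g (W (oppositeCard (Q y) a.1 a.2))), Fintype.sum_prod_type,
      Finset.mul_sum]
    refine Finset.sum_congr rfl fun v _ => ?_
    rw [Finset.mul_sum]
    refine Finset.sum_congr rfl fun t _ => ?_
    have h := congrArg (Int.cast : ℤ → ℚ)
      (card_level_inter_eq_quadraticChar Q y Z hp hN hV hy v t)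
    push_cast at h
    rw [Finset.sum_const, nsmul_eq_mul, ← mul_assoc, ← h]
    simp only [Prod.mk.injEq]
  rw [Finset.sum_congr rfl fun x _ => hterm x, Finset.sum_add_distrib, ← Finset.sum_mul,
    ← Finset.natCast_card_filter, hker, hjoint] at hsum
  simp only [Finset.sum_const, Finset.card_univ, nsmul_eq_mul, hVq] at hrange
  push_cast at hrange hsum
  refine mul_left_cancel₀ hp2 ?_
  rw [hsplit]
  linear_combination -hsum + g wu * hrange

/-- The weight enumerator, with the joint distribution made explicit. -/
theorem sum_comp_formWeight_eq [Fintype (Module.Dual (ZMod p) V)] (δ : ℚ)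
    (hδ : δ = quadraticChar (ZMod p) (-1)) (g K : ℚ → ℚ)
    (hKg : ∀ r, K r = g ((p - 1) ^ 2 / 2 * (Z ^ 2 * p ^ 2) + Z * p ^ 2 * r)) :
    ∑ l : Module.Dual (ZMod p) V, g (formWeight Q y l)
      = g 0 + (Z ^ 2 * p ^ 4 - Z ^ 2 * p ^ 2)
          * g ((p - 1) / 2 * ((p - 1) * (Z ^ 2 * p ^ 2 + Z * p) - Z * p ^ 2 * (1 - δ)))
        + (Z ^ 2 - 1) * K 0 + (p - 1) * (Z ^ 2 - Z) * K ((p - 1) / 2 - p * (1 - δ) / 2)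
        + (p - 1) / 2 * (2 * (Z ^ 2 * K ((p - 1 - δ * (p - 1)) / 2 - p * (1 - δ) / 2))
          + (p - 3) / 2 * ((Z ^ 2 - Z) * K ((p - 2 + δ) / 2 - p * (1 - δ) / 2))
          + (p - 1) / 2 * ((Z ^ 2 + Z) * K ((p + δ) / 2 - p * (1 - δ) / 2))
          + (p - 1) / 2 * ((Z ^ 2 - Z) * K ((p - 2 - δ) / 2 - p * (1 - δ) / 2))
          + (p + 1) / 2 * ((Z ^ 2 + Z) * K ((p - δ) / 2 - p * (1 - δ) / 2))) := by
  have h2 := ringChar_zmod_ne_two hp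
  set c := Q y with hc
  -- For `v ≠ 0` multiplicity and weight depend only on `α = χ (v c)` and `β = χ (t² - 4 v c)`.
  set G : ℤ → ℤ → ℚ := fun α β => (Z ^ 2 - Z * β)
    * K ((p - 1 - β - δ * α * (if β = 0 then (p : ℚ) - 1 else -1)) / 2 - p * (1 - δ) / 2) with hG
  have h00 : (oppositeCard c 0 0 : ℚ) - p * (1 - δ) / 2 = 0 := by
    have h := congrArg (Int.cast : ℤ → ℚ) (two_mul_oppositeCard_zero_zero (c := c) hy)
    rw [ZMod.card] at h
    push_cast at h
    rw [← hδ] at h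
    linear_combination h / 2
  have h0 : ∑ t : ZMod p, (Z ^ 2 - Z * (quadraticChar (ZMod p) (t ^ 2 - 4 * 0 * c) : ℚ))
        * K (oppositeCard c 0 t - p * (1 - δ) / 2)
      = Z ^ 2 * K 0 + (p - 1) * (Z ^ 2 - Z) * K ((p - 1) / 2 - p * (1 - δ) / 2) := by
    have : ∀ t : ZMod p, (Z ^ 2 - Z * (quadraticChar (ZMod p) (t ^ 2 - 4 * 0 * c) : ℚ))
        * K (oppositeCard c 0 t - p * (1 - δ) / 2)
        = (Z ^ 2 - Z) * K ((p - 1) / 2 - p * (1 - δ) / 2)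
          + if t = 0 then Z ^ 2 * K 0 - (Z ^ 2 - Z) * K ((p - 1) / 2 - p * (1 - δ) / 2) else 0 := by
      intro t
      rw [mul_zero, zero_mul, sub_zero]
      split_ifs with ht
      · rw [ht, h00]
        simp
      · have h := congrArg (Int.cast : ℤ → ℚ) (two_mul_oppositeCard_zero h2 (c := c) hy ht)
        rw [ZMod.card] at h
        push_cast at h
        have h' : (oppositeCard c 0 t : ℚ) = (p - 1) / 2 := by linear_combination h / 2
        rw [h', quadraticChar_sq_one' ht]
        push_cast
        ring
    rw [Finset.sum_congr rfl fun t _ => this t, Finset.sum_add_distrib, Finset.sum_const,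
      Finset.card_univ, ZMod.card, Finset.sum_ite_eq', if_pos (Finset.mem_univ _), nsmul_eq_mul]
    ring
  have hv : ∀ v : ZMod p, ∑ t : ZMod p,
        (Z ^ 2 - Z * (quadraticChar (ZMod p) (t ^ 2 - 4 * v * c) : ℚ))
          * K (oppositeCard c v t - p * (1 - δ) / 2)
      = (if v = 0 then 0 else
          ∑ t : ZMod p, G (quadraticChar (ZMod p) (v * c))
            (quadraticChar (ZMod p) (t ^ 2 - 4 * v * c)))
        + if v = 0 then
          Z ^ 2 * K 0 + (p - 1) * (Z ^ 2 - Z) * K ((p - 1) / 2 - p * (1 - δ) / 2) else 0 := by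
    intro v
    split_ifs with hv
    · rw [hv, h0, zero_add]
    · rw [add_zero]
      refine Finset.sum_congr rfl fun t _ => ?_
      have h := congrArg (Int.cast : ℤ → ℚ) (two_mul_oppositeCard h2 (c := c) hy hv t)
      rw [ZMod.card] at h
      push_cast at h
      rw [hG, ← hδ] at *
      dsimp only
      congr 3
      linear_combination h / 2
  rw [sum_comp_formWeight Q y Z hp hN hV hK hy g _ fun R => rfl]
  simp only [← hδ, ← hKg, ← hc]
  rw [h00, Finset.sum_congr rfl fun v _ => hv v, Finset.sum_add_distrib,
    sum_comp_quadraticChar_discrim h2 hy G, Finset.sum_ite_eq', if_pos (Finset.mem_univ _),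
    ZMod.card]
  have e1 : G 1 0 = Z ^ 2 * K ((p - 1 - δ * (p - 1)) / 2 - p * (1 - δ) / 2) := by
    simp [hG]
  have e2 : G 1 1 = (Z ^ 2 - Z) * K ((p - 2 + δ) / 2 - p * (1 - δ) / 2) := by
    simp only [hG, one_ne_zero, if_false, Int.cast_one]
    congr 2 <;> ring
  have e3 : G 1 (-1) = (Z ^ 2 + Z) * K ((p + δ) / 2 - p * (1 - δ) / 2) := by
    simp only [hG, neg_eq_zero, one_ne_zero, if_false, Int.cast_one, Int.cast_neg]
    congr 2 <;> ring
  have e4 : G (-1) 1 = (Z ^ 2 - Z) * K ((p - 2 - δ) / 2 - p * (1 - δ) / 2) := by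
    simp only [hG, one_ne_zero, if_false, Int.cast_one, Int.cast_neg]
    congr 2 <;> ring
  have e5 : G (-1) (-1) = (Z ^ 2 + Z) * K ((p - δ) / 2 - p * (1 - δ) / 2) := by
    simp only [hG, neg_eq_zero, one_ne_zero, if_false, Int.cast_one, Int.cast_neg]
    congr 2 <;> ring
  rw [e1, e2, e3, e4, e5]
  ring

/-- The weight enumerator when `-1` is a square. -/
theorem sum_comp_formWeight_of_mod_four_eq_one [Fintype (Module.Dual (ZMod p) V)]
    (h1 : quadraticChar (ZMod p) (-1) = 1) (g K : ℚ → ℚ)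
    (hKg : ∀ r, K r = g ((p - 1) ^ 2 / 2 * (Z ^ 2 * p ^ 2) + Z * p ^ 2 * r)) :
    ∑ l : Module.Dual (ZMod p) V, g (formWeight Q y l)
      = g 0 + (Z ^ 2 * p ^ 4 - Z ^ 2 * p ^ 2) * g ((p - 1) / 2 * ((p - 1) * (Z ^ 2 * p ^ 2 + Z * p)))
        + (Z ^ 2 * p - 1) * K 0 + (p ^ 2 - 1) / 2 * Z ^ 2 * K ((p - 1) / 2)
        + (p - 1) ^ 2 / 4 * (Z ^ 2 - Z) * K ((p - 3) / 2)
        + (p - 1) ^ 2 / 4 * (Z ^ 2 + Z) * K ((p + 1) / 2) := by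
  rw [sum_comp_formWeight_eq Q y Z hp hN hV hK hy 1 (by rw [h1]; norm_num) g K hKg]
  rw [sub_self, mul_zero, mul_zero, zero_div, sub_zero, sub_zero, sub_zero, sub_zero, sub_zero,
    sub_zero, one_mul, sub_self, zero_div,
    show ((p : ℚ) - 2 + 1) / 2 = (p - 1) / 2 by ring,
    show ((p : ℚ) - 2 - 1) / 2 = (p - 3) / 2 by ring]
  ring

/-- The weight enumerator when `-1` is not a square. -/
theorem sum_comp_formWeight_of_mod_four_eq_three [Fintype (Module.Dual (ZMod p) V)]
    (h1 : quadraticChar (ZMod p) (-1) = -1) (g K : ℚ → ℚ)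
    (hKg : ∀ r, K r = g ((p - 1) ^ 2 / 2 * (Z ^ 2 * p ^ 2) + Z * p ^ 2 * r)) :
    ∑ l : Module.Dual (ZMod p) V, g (formWeight Q y l)
      = g 0 + (Z ^ 2 * p ^ 4 - Z ^ 2 * p ^ 2)
          * g ((p - 1) / 2 * ((p - 1) * (Z ^ 2 * p ^ 2 + Z * p) - 2 * (Z * p ^ 2)))
        + (Z ^ 2 - 1) * K 0
        + ((p ^ 2 - 1) / 2 * Z ^ 2 - (p - 1) * Z) * K (-(p + 1) / 2)
        + (p - 1) * (p - 3) / 4 * (Z ^ 2 - Z) * K (-(p + 3) / 2)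
        + (p ^ 2 - 1) / 4 * (Z ^ 2 + Z) * K (-(p - 1) / 2)
        + (p - 1) * Z ^ 2 * K (-1) := by
  rw [sum_comp_formWeight_eq Q y Z hp hN hV hK hy (-1) (by rw [h1]; norm_num) g K hKg]
  rw [show (1 : ℚ) - -1 = 2 by norm_num,
    show ((p : ℚ) - 1) / 2 - p * 2 / 2 = -(p + 1) / 2 by ring,
    show ((p : ℚ) - 1 - -1 * (p - 1)) / 2 - p * 2 / 2 = -1 by ring,
    show ((p : ℚ) - 2 + -1) / 2 - p * 2 / 2 = -(p + 3) / 2 by ring,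
    show ((p : ℚ) + -1) / 2 - p * 2 / 2 = -(p + 1) / 2 by ring,
    show ((p : ℚ) - 2 - -1) / 2 - p * 2 / 2 = -(p + 1) / 2 by ring,
    show ((p : ℚ) - -1) / 2 - p * 2 / 2 = -(p - 1) / 2 by ring,
    mul_comm (Z * (p : ℚ) ^ 2) 2]
  ring

end WeightEnumerator

/-! ### Multiplicities read off a table -/

section WeightTables

theorem encard_tableMultiplicity_ne_zero_le (m : ℚ) (T : List (ℚ × ℚ)) :
    {w : ℕ | w ≠ 0 ∧ tableMultiplicity ((0, m) :: T) w ≠ 0}.encard ≤ T.length := by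
  classical
  have hsub : (Nat.cast : ℕ → ℚ) '' {w : ℕ | w ≠ 0 ∧ tableMultiplicity ((0, m) :: T) w ≠ 0}
      ⊆ ((T.map Prod.fst).toFinset : Set ℚ) := by
    rintro _ ⟨w, ⟨hw0, hw⟩, rfl⟩
    by_contra hmem
    simp only [List.coe_toFinset, Set.mem_ofPred_eq, List.mem_map, not_exists, not_and] at hmem
    refine hw ?_
    rw [tableMultiplicity, List.map_cons, List.sum_cons,
      if_neg fun h => hw0 (Nat.cast_eq_zero.mp h.symm), zero_add]
    refine List.sum_eq_zero fun x hx => ?_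
    obtain ⟨r, hr, rfl⟩ := List.mem_map.mp hx
    exact if_neg (hmem r hr)
  rw [← (Nat.cast_injective (R := ℚ)).encard_image]
  refine (Set.encard_le_encard hsub).trans ?_
  rw [Set.encard_coe_eq_coe_finsetCard]
  refine Nat.cast_le.mpr ((List.toFinset_card_le _).trans ?_)
  rw [List.length_map]

/-- In this form `ring_nf` can match the table with the weight enumerator, the indicators acting as
atoms. -/
theorem tableMultiplicity_eq_sum_mul (T : List (ℚ × ℚ)) (w : ℕ) :
    tableMultiplicity T w = (T.map fun r => r.2 * if r.1 = (w : ℚ) then 1 else 0).sum := by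
  simp [tableMultiplicity]

theorem tableMultiplicity_zero_eq (T : List (ℚ × ℚ)) (h : ∀ r ∈ T, r.1 ≠ 0 ∨ r.2 = 0) :
    tableMultiplicity ((0, 1) :: T) 0 = 1 := by
  rw [tableMultiplicity, List.map_cons, List.sum_cons, if_pos (by simp), List.sum_eq_zero, add_zero]
  intro x hx
  obtain ⟨r, hr, rfl⟩ := List.mem_map.mp hx
  rcases h r hr with h | h
  · exact if_neg (by simpa using h)
  · simp [h]

end WeightTables

/-! ### From field elements to codewords -/

section TraceCodes

open Classical in
theorem hammingNorm_codeword {p : ℕ} {F : Type*} [Field F] [Algebra (ZMod p) F]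
    (D : Finset F) (a : F) :
    hammingNorm (codeword p D a)
      = (D.filter fun x => Algebra.trace (ZMod p) F (a * x) ≠ 0).card := by
  rw [hammingNorm, ← Finset.card_map (Function.Embedding.subtype _)]
  congr 1
  ext x
  simp only [Finset.mem_map, Finset.mem_filter, Finset.mem_univ, true_and]
  constructor
  · rintro ⟨z, hz, rfl⟩
    exact ⟨z.2, hz⟩
  · rintro ⟨hxD, hx⟩
    exact ⟨⟨x, hxD⟩, hx, rfl⟩

variable {p : ℕ} [Fact p.Prime] {F : Type*} [Field F] [Fintype F] [Algebra (ZMod p) F]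

open Classical in
theorem exists_of_weightCount_ne_zero {D : Finset F} {w : ℕ}
    (h : weightCount (traceCode p D) w ≠ 0) :
    ∑ a : F, (if (hammingNorm (codeword p D a) : ℚ) = w then (1 : ℚ) else 0) ≠ 0 := by
  obtain ⟨c, ⟨a, rfl⟩, hc⟩ := Set.nonempty_of_ncard_ne_zero h
  rw [← Finset.natCast_card_filter, Nat.cast_ne_zero]
  exact Finset.card_ne_zero_of_mem (a := a) (by simp [hc])

open Classical in
theorem weightCount_of_injective {D : Finset F} (h : Function.Injective (codeword p D)) (w : ℕ) :
    (weightCount (traceCode p D) w : ℚ)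
      = ∑ a : F, if (hammingNorm (codeword p D a) : ℚ) = w then (1 : ℚ) else 0 := by
  have himg : {c : D → ZMod p | c ∈ traceCode p D ∧ hammingNorm c = w}
      = codeword p D '' (Finset.univ.filter fun a : F => hammingNorm (codeword p D a) = w) := by
    ext c
    simp only [traceCode, LinearMap.mem_range, Set.mem_ofPred_eq, Finset.coe_filter,
      Finset.mem_univ, true_and, Set.mem_image]
    constructor
    · rintro ⟨⟨a, rfl⟩, hc⟩
      exact ⟨a, hc, rfl⟩
    · rintro ⟨a, hc, rfl⟩
      exact ⟨⟨a, rfl⟩, hc⟩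
  rw [weightCount, himg, Set.ncard_image_of_injective _ h, Set.ncard_coe_finset]
  simp only [Finset.natCast_card_filter, Nat.cast_inj]

open Classical in
theorem codeword_injective {D : Finset F}
    (h : ∑ a : F, (if (hammingNorm (codeword p D a) : ℚ) = (0 : ℕ) then (1 : ℚ) else 0) = 1) :
    Function.Injective (codeword p D) := by
  rw [← Finset.natCast_card_filter, Nat.cast_eq_one, Finset.card_eq_one] at h
  obtain ⟨b, hb⟩ := h
  have hmem : ∀ a, codeword p D a = 0 → a = b := by
    intro a ha
    rw [← Finset.mem_singleton, ← hb]
    simp [ha]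
  refine (injective_iff_map_eq_zero _).mpr fun a ha => ?_
  rw [hmem a ha, hmem 0 (map_zero _)]

end TraceCodes

/-! ### The defining set as an opposite set -/

section DefiningSet

variable {p : ℕ} [Fact p.Prime] {F : Type*} [Field F] [Fintype F] [Algebra (ZMod p) F]

theorem mem_cyclotomicClass_iff (i : Fin 2) (s : ZMod p) :
    s ∈ cyclotomicClass p i ↔ quadraticChar (ZMod p) s = (-1) ^ (i : ℕ) := by
  fin_cases i
  · simp only [cyclotomicClass, Fin.zero_eta, if_true, Set.mem_ofPred_eq,
      pow_zero]
    constructor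
    · rintro ⟨h0, h⟩
      exact (quadraticChar_one_iff_isSquare h0).mpr h
    · intro h
      have h0 : s ≠ 0 := by
        rintro rfl
        simp at h
      exact ⟨h0, (quadraticChar_one_iff_isSquare h0).mp h⟩
  · simp only [cyclotomicClass, Fin.mk_one, one_ne_zero, if_false, Set.mem_ofPred_eq, pow_one]
    exact quadraticChar_neg_one_iff_not_isSquare.symm

theorem polar_normTraceForm_half (hp : p ≠ 2) (x : F) :
    QuadraticMap.polar (normTraceForm p F) (algebraMap (ZMod p) F 2⁻¹) x
      = Algebra.trace (ZMod p) F x := by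
  have h2 : (2 : ZMod p) ≠ 0 := Ring.two_ne_zero (ringChar_zmod_ne_two hp)
  rw [polar_normTraceForm, ← map_pow, ZMod.pow_card, mul_comm (x ^ p), ← Algebra.smul_def,
    ← Algebra.smul_def, map_smul, map_smul, trace_pow_char, ← add_smul, ← two_mul,
    mul_inv_cancel₀ h2, one_smul]

theorem normTraceForm_half :
    normTraceForm p F (algebraMap (ZMod p) F 2⁻¹) = Module.finrank (ZMod p) F * 2⁻¹ ^ 2 := by
  rw [normTraceForm_apply, ← map_pow, Algebra.trace_algebraMap, pow_succ, ZMod.pow_card, sq,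
    nsmul_eq_mul]

theorem finrank_eq_of_card {e : ℕ} (hF : Fintype.card F = p ^ e) :
    Module.finrank (ZMod p) F = e := by
  have h := Module.card_eq_pow_finrank (K := ZMod p) (V := F)
  rw [hF, ZMod.card] at h
  exact (Nat.pow_right_injective (Fact.out : p.Prime).two_le h).symm

/-- Completing the square at `1/2`; the sign `(-1) ^ (1 - i)` is minus the sign `(-1) ^ i` that
defines `C_i`. -/
theorem definingSet_eq_oppositeSet (hp : p ≠ 2) {i : Fin 2}
    (hi : quadraticChar (ZMod p) (normTraceForm p F (algebraMap (ZMod p) F 2⁻¹))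
      = (-1) ^ (1 - (i : ℕ))) :
    definingSet p F i = oppositeSet (normTraceForm p F) (algebraMap (ZMod p) F 2⁻¹) := by
  have hi' : -(-1 : ℤ) ^ (1 - (i : ℕ)) = (-1) ^ (i : ℕ) := by
    fin_cases i <;> simp
  ext x
  have hx : Algebra.trace (ZMod p) F (x ^ (p + 1) - x)
      = normTraceForm p F (x - algebraMap (ZMod p) F 2⁻¹)
        - normTraceForm p F (algebraMap (ZMod p) F 2⁻¹) := by
    have h := map_add_smul (normTraceForm p F) x (algebraMap (ZMod p) F 2⁻¹) (-1)
    rw [neg_one_smul, ← sub_eq_add_neg, polar_normTraceForm_half hp, normTraceForm_apply p F x] at h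
    rw [map_sub, h]
    ring
  simp only [definingSet, oppositeSet, Finset.mem_filter, Finset.mem_univ, true_and, hx,
    mem_cyclotomicClass_iff, hi, hi']

/-- Nondegeneracy of the trace form makes `a ↦ Tr (a ·)` a bijection from `F` to its dual. -/
theorem sum_comp_hammingNorm [Fintype (Module.Dual (ZMod p) F)] {D : Finset F} {y : F}
    (hD : D = oppositeSet (normTraceForm p F) y) (g : ℚ → ℚ) :
    ∑ a : F, g (hammingNorm (codeword p D a)) = ∑ l, g (formWeight (normTraceForm p F) y l) := by
  refine Fintype.sum_equiv ((Algebra.traceForm (ZMod p) F).toDual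
    (traceForm_nondegenerate (ZMod p) F)).toEquiv _ _ fun a => ?_
  rw [hammingNorm_codeword, formWeight, hD]
  rfl

variable {n : ℕ} (hp : p ≠ 2) (hF : Fintype.card F = p ^ (4 * (n + 1))) {D : Finset F}
  (hy : normTraceForm p F (algebraMap (ZMod p) F 2⁻¹) ≠ 0)
  (hD : D = oppositeSet (normTraceForm p F) (algebraMap (ZMod p) F 2⁻¹))
include hp hF

theorem levelCard_normTraceForm (s : ZMod p) :
    (levelCard (normTraceForm p F) s : ℤ)
      = ((p : ℤ) ^ (2 * n)) ^ 2 * p ^ 3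
        + (p : ℤ) ^ (2 * n) * p ^ 2 * (1 - if s = 0 then (p : ℤ) else 0) := by
  have h := mul_levelCard_normTraceForm hp ⟨n + 1, rfl⟩ hF s
  have hp0 : (p : ℤ) ≠ 0 := by exact_mod_cast (Fact.out : p.Prime).ne_zero
  refine mul_left_cancel₀ hp0 ?_
  rw [h, show 4 * (n + 1) / 2 + 1 = 2 * n + 3 by omega]
  ring

include hy hD

theorem card_definingSet :
    2 * (D.card : ℤ) = (p - 1) * (((p : ℤ) ^ (2 * n)) ^ 2 * p ^ 3 + (p : ℤ) ^ (2 * n) * p ^ 2)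
      - (p : ℤ) ^ (2 * n) * p ^ 3 * (1 - quadraticChar (ZMod p) (-1)) := by
  rw [hD]
  exact card_oppositeSet _ _ _ hp (levelCard_normTraceForm hp hF) hy

theorem sum_weight_eq_tableMultiplicity_one (h1 : quadraticChar (ZMod p) (-1) = 1) (w : ℕ) :
    ∑ a : F, (if (hammingNorm (codeword p D a) : ℚ) = w then (1 : ℚ) else 0)
      = tableMultiplicity (weightTableOne p (4 * (n + 1))) w := by
  have : Fintype (Module.Dual (ZMod p) F) := Fintype.ofEquiv F ((Algebra.traceForm (ZMod p) F).toDual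
    (traceForm_nondegenerate (ZMod p) F)).toEquiv
  rw [sum_comp_hammingNorm hD fun x => if x = (w : ℚ) then (1 : ℚ) else 0,
    sum_comp_formWeight_of_mod_four_eq_one _ _ _ hp (levelCard_normTraceForm hp hF)
      (by rw [hF]; push_cast; ring) (card_ker_polarBilin_normTraceForm hp ⟨n + 1, rfl⟩ hF) hy h1
      (fun x => if x = (w : ℚ) then (1 : ℚ) else 0) _ fun r => rfl,
    tableMultiplicity_eq_sum_mul, weightTableOne, show 4 * (n + 1) - 2 = 4 * n + 2 by omega,
    show 4 * (n + 1) / 2 - 1 = 2 * n + 1 by omega, show 4 * (n + 1) - 3 = 4 * n + 1 by omega,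
    show 4 * (n + 1) - 4 = 4 * n by omega, show 4 * (n + 1) / 2 - 2 = 2 * n by omega,
    show 4 * (n + 1) / 2 = 2 * n + 2 by omega]
  simp only [List.map_cons, List.map_nil, List.sum_cons, List.sum_nil]
  push_cast
  ring_nf

theorem sum_weight_eq_tableMultiplicity_three (h1 : quadraticChar (ZMod p) (-1) = -1) (w : ℕ) :
    ∑ a : F, (if (hammingNorm (codeword p D a) : ℚ) = w then (1 : ℚ) else 0)
      = tableMultiplicity (weightTableThree p (4 * (n + 1))) w := by
  have : Fintype (Module.Dual (ZMod p) F) := Fintype.ofEquiv F ((Algebra.traceForm (ZMod p) F).toDual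
    (traceForm_nondegenerate (ZMod p) F)).toEquiv
  rw [sum_comp_hammingNorm hD fun x => if x = (w : ℚ) then (1 : ℚ) else 0,
    sum_comp_formWeight_of_mod_four_eq_three _ _ _ hp (levelCard_normTraceForm hp hF)
      (by rw [hF]; push_cast; ring) (card_ker_polarBilin_normTraceForm hp ⟨n + 1, rfl⟩ hF) hy h1
      (fun x => if x = (w : ℚ) then (1 : ℚ) else 0) _ fun r => rfl,
    tableMultiplicity_eq_sum_mul, weightTableThree, show 4 * (n + 1) - 2 = 4 * n + 2 by omega,
    show 4 * (n + 1) / 2 - 1 = 2 * n + 1 by omega,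
    show 4 * (n + 1) - 4 = 4 * n by omega, show 4 * (n + 1) / 2 - 2 = 2 * n by omega,
    show 4 * (n + 1) / 2 = 2 * n + 2 by omega]
  simp only [List.map_cons, List.map_nil, List.sum_cons, List.sum_nil]
  push_cast
  ring_nf

end DefiningSet

/-! ### Weight zero in the tables and the main theorem -/

theorem tableMultiplicity_weightTableOne_zero {p : ℕ} (hp : 3 ≤ p) (e : ℕ) :
    tableMultiplicity (weightTableOne p e) 0 = 1 := by
  have hp' : (3 : ℚ) ≤ p := by exact_mod_cast hp
  have h0 : (0 : ℚ) < p := by linarith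
  have h1 : (0 : ℚ) < p - 1 := by linarith
  have h3 : (0 : ℚ) ≤ p - 3 := by linarith
  refine tableMultiplicity_zero_eq _ fun r hr => Or.inl ?_
  simp only [List.mem_cons, List.not_mem_nil, or_false] at hr
  rcases hr with rfl | rfl | rfl | rfl | rfl <;> dsimp only <;> positivity

/-- The hypothesis makes the row with the largest subtracted multiple of `p ^ (e / 2)`, the one with
`p + 3`, positive. It fails for `p = 3`, `n = 0`. -/
theorem tableMultiplicity_weightTableThree_zero {p : ℕ} (hp : 3 ≤ p) (n : ℕ)
    (h : (p : ℚ) + 3 < (p - 1) ^ 2 * p ^ (2 * n)) :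
    tableMultiplicity (weightTableThree p (4 * (n + 1))) 0 = 1 := by
  have hp' : (3 : ℚ) ≤ p := by exact_mod_cast hp
  have h0 : (0 : ℚ) < p := by linarith
  have hZ : (1 : ℚ) ≤ (p : ℚ) ^ (2 * n) := one_le_pow₀ (by linarith)
  have hZ0 : (0 : ℚ) < (p : ℚ) ^ (2 * n) := by positivity
  refine tableMultiplicity_zero_eq _ fun r hr => Or.inl (ne_of_gt ?_)
  rw [show 4 * (n + 1) - 2 = 2 * n + 2 * n + 2 by omega,
    show 4 * (n + 1) / 2 - 1 = 2 * n + 1 by omega,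
    show 4 * (n + 1) / 2 = 2 * n + 2 by omega] at hr
  simp only [List.mem_cons, List.not_mem_nil, or_false, pow_add, pow_one] at hr
  generalize (p : ℚ) ^ (2 * n) = Z at *
  have key : ∀ a : ℚ, a ≤ p + 3 →
      0 < ((p : ℚ) - 1) ^ 2 / 2 * (Z * Z * p ^ 2) - a / 2 * (Z * p ^ 2) := by
    intro a ha
    have : ((p : ℚ) - 1) ^ 2 / 2 * (Z * Z * p ^ 2) - a / 2 * (Z * p ^ 2)
        = Z * p ^ 2 / 2 * ((p - 1) ^ 2 * Z - a) := by ring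
    rw [this]
    exact mul_pos (by positivity) (by linarith)
  rcases hr with rfl | rfl | rfl | rfl | rfl | rfl <;> dsimp only
  · have : ((p : ℚ) - 1) ^ 2 / 2 * (Z * Z * p ^ 2) - (p ^ 2 - 1) / 2 * (Z * p)
        = (p - 1) * (Z * p) / 2 * ((p - 1) * p * Z - (p + 1)) := by ring
    rw [this]
    refine mul_pos (div_pos (mul_pos (by linarith) (by positivity)) two_pos) ?_
    nlinarith
  · have h1 : (0 : ℚ) < p - 1 := by linarith
    positivity
  · exact key _ (by linarith)
  · exact key _ le_rfl
  · exact key _ (by linarith)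
  · have := key 2 (by linarith)
    linarith

theorem theorem9 (p : ℕ) [Fact p.Prime] (hp : p ≠ 2) (e : ℕ) (he : 4 ∣ e) (i : Fin 2)
    (hi : legendreSym p (e : ℤ) = (-1) ^ (1 - (i : ℕ)))
    (F : Type*) [Field F] [Fintype F] [Algebra (ZMod p) F] (hF : Fintype.card F = p ^ e) :
    ((definingSet p F i).card : ℚ)
        = ((p : ℚ) - 1) / 2 * (p : ℚ) ^ (e - 1)
          - (1 - (quadraticChar (ZMod p) (-1) : ℚ) * (p : ℚ)) / 2 * (p : ℚ) ^ (e / 2) ∧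
    {w : ℕ | w ≠ 0 ∧ weightCount (traceCode p (definingSet p F i)) w ≠ 0}.encard ≤ 6 ∧
    (¬ (p = 3 ∧ e = 4) →
      Module.finrank (ZMod p) (traceCode p (definingSet p F i)) = e ∧
      (p % 4 = 1 → ∀ w : ℕ, (weightCount (traceCode p (definingSet p F i)) w : ℚ)
        = tableMultiplicity (weightTableOne p e) w) ∧
      (p % 4 = 3 → ∀ w : ℕ, (weightCount (traceCode p (definingSet p F i)) w : ℚ)
        = tableMultiplicity (weightTableThree p e) w)) := by
  have hpp : p.Prime := Fact.out
  have hp3 : 3 ≤ p := by have := hpp.two_le; omega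
  obtain ⟨m, rfl⟩ := he
  obtain ⟨n, rfl⟩ : ∃ n, m = n + 1 := by
    refine Nat.exists_eq_succ_of_ne_zero ?_
    -- Exponent `0` would give a field with one element.
    rintro rfl
    exact Fintype.one_lt_card.ne' (by simpa using hF)
  have h2 : (2 : ZMod p) ≠ 0 := Ring.two_ne_zero (ringChar_zmod_ne_two hp)
  have hQ : quadraticChar (ZMod p) (normTraceForm p F (algebraMap (ZMod p) F 2⁻¹))
      = (-1) ^ (1 - (i : ℕ)) := by
    rw [normTraceForm_half, finrank_eq_of_card hF, map_mul, quadraticChar_sq_one' (inv_ne_zero h2),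
      mul_one, ← hi, legendreSym]
    simp
  have hy : normTraceForm p F (algebraMap (ZMod p) F 2⁻¹) ≠ 0 := by
    intro h
    rw [h, quadraticChar_zero] at hQ
    exact pow_ne_zero _ (by norm_num) hQ.symm
  have hD := definingSet_eq_oppositeSet hp hQ
  have hodd : p % 4 = 1 ∨ p % 4 = 3 := by
    have := hpp.eq_two_or_odd
    omega
  have hη1 : p % 4 = 1 → quadraticChar (ZMod p) (-1) = 1 := fun h => by
    rw [quadraticChar_neg_one (ringChar_zmod_ne_two hp), ZMod.card, ZMod.χ₄_nat_one_mod_four h]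
  have hη3 : p % 4 = 3 → quadraticChar (ZMod p) (-1) = -1 := fun h => by
    rw [quadraticChar_neg_one (ringChar_zmod_ne_two hp), ZMod.card, ZMod.χ₄_nat_three_mod_four h]
  have hT1 := fun h w => sum_weight_eq_tableMultiplicity_one hp hF hy hD (hη1 h) w
  have hT3 := fun h w => sum_weight_eq_tableMultiplicity_three hp hF hy hD (hη3 h) w
  refine ⟨?_, ?_, fun hne => ?_⟩
  · have h := congrArg (Int.cast : ℤ → ℚ) (card_definingSet hp hF hy hD)
    push_cast at h
    rw [show 4 * (n + 1) - 1 = 4 * n + 3 by omega, show 4 * (n + 1) / 2 = 2 * n + 2 by omega]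
    linear_combination h / 2
  · rcases hodd with h | h
    · refine le_trans (Set.encard_le_encard ?_) ((encard_tableMultiplicity_ne_zero_le 1
        (weightTableOne p (4 * (n + 1))).tail).trans (by simp [weightTableOne]; norm_num))
      rintro w ⟨hw0, hw⟩
      exact ⟨hw0, (hT1 h w) ▸ exists_of_weightCount_ne_zero hw⟩
    · refine le_trans (Set.encard_le_encard ?_) ((encard_tableMultiplicity_ne_zero_le 1
        (weightTableThree p (4 * (n + 1))).tail).trans (by simp [weightTableThree]))
      rintro w ⟨hw0, hw⟩
      exact ⟨hw0, (hT3 h w) ▸ exists_of_weightCount_ne_zero hw⟩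
  · have hinj : Function.Injective (codeword p (definingSet p F i)) := by
      refine codeword_injective ?_
      rcases hodd with h | h
      · rw [hT1 h, tableMultiplicity_weightTableOne_zero hp3]
      · rw [hT3 h, tableMultiplicity_weightTableThree_zero hp3]
        have hZ : (1 : ℚ) ≤ (p : ℚ) ^ (2 * n) := one_le_pow₀ (by exact_mod_cast hpp.one_lt.le)
        rcases Nat.lt_or_ge p 7 with h7 | h7
        -- Below `7` the only prime that is `3` modulo `4` is `3`, and then the excluded pair forces
        -- `n ≥ 1`.
        · have hp3' : p = 3 := by omega
          subst hp3'
          obtain ⟨k, rfl⟩ : ∃ k, n = k + 1 :=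
            Nat.exists_eq_succ_of_ne_zero fun hn => hne ⟨rfl, by rw [hn]⟩
          have hk : (1 : ℚ) ≤ (3 : ℚ) ^ (2 * k) := one_le_pow₀ (by norm_num)
          rw [show 2 * (k + 1) = 2 * k + 2 by ring, pow_add]
          push_cast
          linarith
        · have h7' : (7 : ℚ) ≤ p := by exact_mod_cast h7
          nlinarith [sq_nonneg ((p : ℚ) - 1)]
    refine ⟨?_, fun h w => ?_, fun h w => ?_⟩
    · rw [traceCode, LinearMap.finrank_range_of_inj hinj, finrank_eq_of_card hF]
    · rw [weightCount_of_injective hinj, hT1 h]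
    · rw [weightCount_of_injective hinj, hT3 h]
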